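/- Let $\lambda>1/2$, $\lambda\neq 1$, and write $(\lambda)_n=\lambda(\lambda+1)\cdots(\lambda+n-1)$. Let $\mu$ be a probability measure on $\mathbb R$ with finite moments of all orders, zero mean and unit variance. Let $(P_n)_{n\ge 0}$ be monic orthogonal polynomials for $\mu$ ($\deg P_n=n$), with Jacobi–Szegő parameters $(\alpha_n),(\omega_n)$, i.e. $xP_n=P_{n+1}+\alpha_nP_n+\omega_nP_{n-1}$ for $n\ge 0$, with $P_{-1}=0$, $\omega_0=1$. Suppose that there are a non-empty open set $S\subseteq\mathbb C\setminus(-\infty,0]$, each of whose connected components has $0$ in its closure, and analytic functions $f,u:S\to\mathbb C$ such that $\Im f\ne 0$ on $S$, $zf(z)\to 1$ and $u(z)/z^\lambda\to 1$ as $z\to 0$ in $S$ (principal powers throughout), $$\sum_{n\ge 0}\frac{(\lambda)_n}{n!}P_n(x)z^n=\frac{1}{u(z)\,(f(z)-x)^{\lambda}}\qquad (z\in S,\ x\in\operatorname{supp}\mu),$$ and, for $z\in S$ and $i=0,1,2$, $$\int\sum_{n\ge0}\frac{(\lambda)_n}{n!}x^iP_n(x)z^n\,\mu(dx)=\sum_{n\ge0}\frac{(\lambda)_n}{n!}\Big(\int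 x^iP_n(x)\,\mu(dx)\Big)z^n .$$ Suppose moreover that $\alpha_1\neq0$ and that, for some $a_0,a_1,a_2\in\mathbb C$, $$g(z):=f(z)-\tfrac12\big[(\lambda+1)\omega_2z+\alpha_1\big]=\frac{a_0z^2+a_1z+a_2}{z}\qquad(z\in S).\tag{1}$$ **(a)** Then $$\omega_2=\frac{2\lambda^3}{(\lambda+1)^2(\lambda-1/2)},\qquad \alpha_1^2=\frac{2}{(\lambda+1)^2(\lambda-1/2)},\qquad a_0=\frac{(1-\lambda)\lambda^2}{(\lambda+1)(2\lambda-1)},\quad a_1=\frac{\lambda\alpha_1}{2},\quad a_2=1 .$$ Let $\epsilon=\pm1$ be the sign of $\alpha_1$ and put $r=\sqrt{2\lambda-1}$. Then for all $z\in S$ $$f(z)=\frac1z\Big[\frac{\lambda^2}{2\lambda-1}z^2+\frac{\epsilon}{r}z+1\Big],\qquad u(z)=\epsilon\,\frac{r}{\lambda}\,\frac{z^\lambda}{z+\epsilon r/\lambda},$$ and for all $z\in S$ and $x\in\operatorname{supp}\mu$ $$\sum_{n\ge0}\frac{(\lambda)_n}{n!}P_n(x)z^n=\epsilon\,\frac{\lambda}{r}\Big[z+\epsilon\frac{r}{\lambda}\Big]\Big[1-z\Big(x-\frac{\epsilon}{r}\Big)+\frac{\lambda^2}{2\lambda-1}z^2\Big]^{-\lambda}.$$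 Let $p_n^{a,b}$ be the monic Jacobi polynomials, i.e. $p_n^{a,b}=\frac{2^nn!}{(n+a+b+1)_n}P_n^{a,b}$ where $P_n^{a,b}(y)=\frac{(a+1)_n}{n!}\,{}_2F_1(-n,n+a+b+1;a+1;\frac{1-y}2)$. Let $(a,b)=(\lambda-\frac12,\lambda-\frac32)$ if $\epsilon=1$ and $(a,b)=(\lambda-\frac32,\lambda-\frac12)$ if $\epsilon=-1$, and put $y(x)=\frac{rx-\epsilon}{2\lambda}$. Then for all $n$ and $x$ $$P_n(x)=\Big[\frac{2\lambda}{r}\Big]^n p_n^{a,b}(y(x)),$$ and $\mu$ is the affinely shifted Beta distribution $$\mu(dx)=c\,(1-y(x))^{a}(1+y(x))^{b}\,dx$$ with a normalizing constant $c>0$, on the interval $\{x: |y(x)|\le1\}$, i.e. on $\big[\frac{1-2\lambda}{r},\frac{1+2\lambda}{r}\big]$ if $\epsilon=1$ and on $\big[-\frac{1+2\lambda}{r},\frac{2\lambda-1}{r}\big]$ if $\epsilon=-1$. **(b)** Conversely, for each sign $\epsilon=\pm1$ there exist $\mu,(P_n),(\alpha_n),(\omega_n),S,f,u,a_0,a_1,a_2$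 satisfying all of the above hypotheses, including (1), with $\alpha_1$ of sign $\epsilon$. -/

import Mathlib

open MeasureTheory Filter Topology
open scoped Polynomial Nat

namespace UltrasphericalType

/-- `μ` is a standard probability measure with finite moments of all orders:
zero mean and unit variance. -/
structure IsStandard (μ : Measure ℝ) : Prop where
  prob : IsProbabilityMeasure μ
  moments : ∀ n : ℕ, Integrable (fun x : ℝ => x ^ n) μ
  mean : ∫ x, x ∂μ = 0
  variance : ∫ x, x ^ 2 ∂μ = 1

/-- `P 0, P 1, …` are monic orthogonal polynomials for `μ`, with `P n` of degree `n`. -/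
structure IsMonicOPS (μ : Measure ℝ) (P : ℕ → ℝ[X]) : Prop where
  monic : ∀ n, (P n).Monic
  degree : ∀ n, (P n).natDegree = n
  orthogonal : ∀ m n, m ≠ n → ∫ x, (P m).eval x * (P n).eval x ∂μ = 0

/-- `α`, `ω` are the Jacobi–Szegő parameters of the monic sequence `P`:
`x P_n = P_{n+1} + α_n P_n + ω_n P_{n-1}` for `n ≥ 0`, where `P_{-1} = 0` and `ω_0 = 1`. -/
structure IsJacobiSzego (P : ℕ → ℝ[X]) (α ω : ℕ → ℝ) : Prop where
  omega_zero : ω 0 = 1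
  rec_zero : Polynomial.X * P 0 = P 1 + Polynomial.C (α 0) * P 0
  rec_succ : ∀ n, Polynomial.X * P (n + 1) =
    P (n + 2) + Polynomial.C (α (n + 1)) * P (n + 1) + Polynomial.C (ω (n + 1)) * P n

/-- An open set near `0` that avoids the cut `(-∞, 0]`, each of whose connected components has
`0` as a boundary point. (Examples: a half disc `‖z‖ < r, 0 < Im z`; the disc `‖z‖ < r` deprived
of the real axis.) -/
structure IsCutRegion (S : Set ℂ) : Prop where
  isOpen : IsOpen S
  nonempty : S.Nonempty
  cut : S ⊆ Complex.slitPlane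
  near_zero : ∀ z ∈ S, (0 : ℂ) ∈ closure (connectedComponentIn S z)

/-- The coefficient `(λ)_n / n!`, where `(λ)_n = λ (λ + 1) ⋯ (λ + n - 1)`. -/
noncomputable def coeff (lam : ℝ) (n : ℕ) : ℝ := (ascPochhammer ℝ n).eval lam / (n ! : ℝ)

/-- `∑ (λ)_n / n! P_n(x) z^n = 1 / (u(z) (f(z) - x)^λ)` for `z ∈ S` and `x` in the support of `μ`
(generating function of ultraspherical type), together with the requirements on `f` and `u`, and
with the exchange of `∑` and `∫` against `x^i`, `i = 0, 1, 2`. -/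
structure HasUltrasphericalGF (lam : ℝ) (μ : Measure ℝ) (P : ℕ → ℝ[X])
    (S : Set ℂ) (f u : ℂ → ℂ) : Prop where
  region : IsCutRegion S
  analytic_f : AnalyticOnNhd ℂ f S
  analytic_u : AnalyticOnNhd ℂ u S
  lim_f : Tendsto (fun z => z * f z) (𝓝[S] 0) (𝓝 1)
  lim_u : Tendsto (fun z => u z / z ^ (lam : ℂ)) (𝓝[S] 0) (𝓝 1)
  im_f : ∀ z ∈ S, (f z).im ≠ 0
  hasSum : ∀ z ∈ S, ∀ x ∈ μ.support,
    HasSum (fun n : ℕ => ((coeff lam n * (P n).eval x : ℝ) : ℂ) * z ^ n)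
      (1 / (u z * (f z - (x : ℂ)) ^ (lam : ℂ)))
  exchange : ∀ z ∈ S, ∀ i : ℕ, i ≤ 2 →
    ∫ x, (∑' n : ℕ, ((coeff lam n * (x ^ i * (P n).eval x) : ℝ) : ℂ) * z ^ n) ∂μ =
      ∑' n : ℕ, ((coeff lam n * ∫ x, x ^ i * (P n).eval x ∂μ : ℝ) : ℂ) * z ^ n

/-- `g_λ = f_λ - Q_1 / 2`, where `Q_1(z) = (λ + 1) ω_2 z + α_1`. -/
noncomputable def gFun (lam α₁ ω₂ : ℝ) (f : ℂ → ℂ) (z : ℂ) : ℂ :=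
  f z - (((lam : ℂ) + 1) * (ω₂ : ℂ) * z + (α₁ : ℂ)) / 2

/-- The Jacobi polynomial
`P_n^{a,b}(y) = (1/n!) ∑_k (n choose k) (n+a+b+1)_k (a+k+1)_{n-k} ((y-1)/2)^k`,
that is `((a+1)_n / n!) ₂F₁(-n, n+a+b+1; a+1; (1-y)/2)`. -/
noncomputable def jacobi (a b : ℝ) (n : ℕ) : ℝ[X] :=
  ∑ k ∈ Finset.range (n + 1),
    Polynomial.C ((n.choose k : ℝ) / (n ! : ℝ)
        * (ascPochhammer ℝ k).eval ((n : ℝ) + a + b + 1)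
        * (ascPochhammer ℝ (n - k)).eval (a + (k : ℝ) + 1))
      * (Polynomial.C (1 / 2 : ℝ) * (Polynomial.X - 1)) ^ k

/-- The monic Jacobi polynomial `p_n^{a,b} = (2^n n! / (n+a+b+1)_n) P_n^{a,b}`. -/
noncomputable def monicJacobi (a b : ℝ) (n : ℕ) : ℝ[X] :=
  Polynomial.C (2 ^ n * (n ! : ℝ) / (ascPochhammer ℝ n).eval ((n : ℝ) + a + b + 1)) * jacobi a b n

/-- The measure `c (1 - y(x))^a (1 + y(x))^b dx` on the interval `[l, r]`. -/
noncomputable def betaMeasureOn (c a b l r : ℝ) (y : ℝ → ℝ) : Measure ℝ :=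
  (volume.restrict (Set.Icc l r)).withDensity
    (fun x => ENNReal.ofReal (c * ((1 - y x) ^ a * (1 + y x) ^ b)))

end UltrasphericalType

/-!
Classification of the generating functions of ultraspherical type with `f(z) = A z + B + C / z`.

When the generating function is integrated against `x ^ i`, `i ≤ 2`, orthogonality leaves finitely
many terms of the series, so that with `F_p = ∫ (f(z) - x) ^ p dμ` the integrals `F_{-lam}`,
`F_{1 - lam}`, `F_{2 - lam}` become `u` times explicit polynomials in `z` and `f`
(`HasUltrasphericalGF.integral_eq`). On the other hand `F_{p + 1}' = (p + 1) f' F_p`. For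
`p = -lam` this is a linear differential equation for `u` (`HasUltrasphericalGF.deriv_u`);
inserting it into the case `p = 1 - lam` eliminates `u` and leaves a Riccati-type equation for `f`
(`HasUltrasphericalGF.riccati`). If `f = A z + B + C / z`, then `C = 1` by the behaviour at `0`,
and the Riccati equation is a polynomial identity of degree four, whose coefficients determine
`A`, `B`, `ω 2` and `(α 1) ^ 2` (`solve_parameters`, `HasUltrasphericalGF.parameters`).

With `f` known, the equation for `u` integrates to `u = z ^ lam / (1 + lam s z)`, where
`s = eps / √(2 lam - 1)` and `eps` is the sign of `α 1`; the constant of integration is found on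
each component of the region by letting `z` tend to `0` (`HasUltrasphericalGF.u_mul_eq`). Near
`0`, and hence on each component, `Im z` and `Im f` have opposite signs, so the principal powers
combine and the generating function becomes `(1 + lam s z) (1 - z (x - s) + A z ^ 2) ^ (-lam)`.

After scaling `z` this is `(1 + eps t) (1 - 2 y t + t ^ 2) ^ (-lam)` with `y` affine in `x`, whose
coefficients are the combinations `C_n + eps C_{n - 1}` of Gegenbauer polynomials, and these are
Jacobi polynomials with parameters `lam - 1 ± eps / 2` (`coeff_mul_eval_monicJacobi`). Uniqueness
of power series, applied at a fixed point `x` of the support, identifies `P n` on the support of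
`μ`. The recurrence satisfied by the Jacobi polynomials has `ω n > 0`, which excludes a finite
support, so the identity holds between polynomials (`IsMonicOPS.eq_of_ae_eq`). Thus `μ` has the
same moments as a shifted Beta distribution, and, the latter being compactly supported, is equal
to it (`eq_of_momentFunctional_eq`).

Conversely, for the shifted Beta distribution and `f`, `u` as above, all requirements hold on a
small upper half disc (`hasUltrasphericalGF_shiftedJacobi`): the series are dominated, uniformly
on the support, by a convergent series of constants (`exchange_shiftedJacobi`), so sum and
integral may be exchanged.
-/

namespace UltrasphericalType

/-! ### The coefficients `(c)_n / n!` and powers of complex numbers -/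

lemma coeff_zero (c : ℝ) : coeff c 0 = 1 := by simp [coeff]

lemma coeff_one (c : ℝ) : coeff c 1 = c := by simp [coeff]

lemma coeff_two (c : ℝ) : coeff c 2 = c * (c + 1) / 2 := by
  simp [coeff, ascPochhammer_succ_eval]

lemma coeff_pos {c : ℝ} (hc : 0 < c) (n : ℕ) : 0 < coeff c n :=
  div_pos (ascPochhammer_pos n c hc) (by positivity)

lemma choose_eq_coeff (c : ℝ) (n : ℕ) : Ring.choose ((c : ℂ) + n - 1) n = (coeff c n : ℂ) := by
  have h := Ring.descPochhammer_eq_factorial_smul_choose ((c : ℂ) + n - 1) n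
  rw [Polynomial.descPochhammer_smeval_eq_ascPochhammer] at h
  rw [Polynomial.ascPochhammer_smeval_eq_eval, nsmul_eq_mul,
    show (c : ℂ) + n - 1 - n + 1 = c by ring] at h
  have h2 : ((ascPochhammer ℂ n).eval (c : ℂ)) = (((ascPochhammer ℝ n).eval c : ℝ) : ℂ) := by
    have h3 := Polynomial.eval_map_apply (f := Complex.ofRealHom) (p := ascPochhammer ℝ n) c
    rw [ascPochhammer_map] at h3
    exact h3
  have hn : ((n ! : ℕ) : ℂ) ≠ 0 := by exact_mod_cast n.factorial_ne_zero
  rw [coeff, Complex.ofReal_div, ← h2, h, Complex.ofReal_natCast, mul_div_cancel_left₀ _ hn]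

/-- The binomial series. -/
lemma hasSum_coeff (c : ℝ) {s : ℂ} (hs : ‖s‖ < 1) :
    HasSum (fun n => (coeff c n : ℂ) * s ^ n) ((1 - s) ^ (-(c : ℂ))) := by
  have h := (Complex.one_div_one_sub_cpow_hasFPowerSeriesOnBall_zero (c : ℂ)).hasSum (y := s)
    (by simpa [enorm_eq_nnnorm, ← NNReal.coe_lt_coe] using hs)
  rw [zero_add] at h
  rw [show (1 - s) ^ (-(c : ℂ)) = 1 / (1 - s) ^ (c : ℂ) by rw [Complex.cpow_neg, one_div]]
  convert! h using 2 with n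
  simp [choose_eq_coeff, mul_comm]

lemma hasSum_coeff_real (c : ℝ) {s : ℝ} (hs : 0 ≤ s) (hs1 : s < 1) :
    HasSum (fun n => coeff c n * s ^ n) ((1 - s) ^ (-c)) := by
  have h := hasSum_coeff c (s := (s : ℂ)) (by simpa [abs_of_nonneg hs] using hs1)
  rw [← Complex.hasSum_ofReal]
  rw [Complex.ofReal_cpow (by linarith)]
  push_cast
  exact h

lemma mul_cpow_of_arg {x y : ℂ} (hx : x ≠ 0) (hy : y ≠ 0)
    (h : x.arg + y.arg ∈ Set.Ioc (-Real.pi) Real.pi) (c : ℂ) :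
    (x * y) ^ c = x ^ c * y ^ c := by
  rw [Complex.cpow_def_of_ne_zero (mul_ne_zero hx hy), Complex.cpow_def_of_ne_zero hx,
    Complex.cpow_def_of_ne_zero hy, (Complex.log_mul_eq_add_log_iff hx hy).2 h, add_mul,
    Complex.exp_add]

lemma mul_cpow_of_re_pos {x y : ℂ} (hx : 0 < x.re) (hy : 0 < y.re) (c : ℂ) :
    (x * y) ^ c = x ^ c * y ^ c := by
  have hx0 : x ≠ 0 := by rintro rfl; simp at hx
  have hy0 : y ≠ 0 := by rintro rfl; simp at hy
  have h1 := abs_lt.1 (Complex.abs_arg_lt_pi_div_two_iff.2 (Or.inl hx))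
  have h2 := abs_lt.1 (Complex.abs_arg_lt_pi_div_two_iff.2 (Or.inl hy))
  exact mul_cpow_of_arg hx0 hy0 ⟨by linarith, by linarith⟩ c

lemma re_pos_of_norm_sub_one_lt {x : ℂ} (h : ‖x - 1‖ < 1) : 0 < x.re := by
  have := (Complex.abs_re_le_norm (x - 1)).trans_lt h
  rw [Complex.sub_re, Complex.one_re, abs_lt] at this
  linarith

/-! ### Gegenbauer polynomials and their generating function -/

/-- The value at `y = 2 w + 1` of the Gegenbauer polynomial `C_n^{lam}`, expanded in powers of
`w = (y - 1) / 2`. -/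
noncomputable def gegenbauer (lam : ℝ) (n : ℕ) (w : ℝ) : ℝ :=
  ∑ p ∈ Finset.HasAntidiagonal.antidiagonal n,
    coeff lam p.1 * (4 * w) ^ p.1 * coeff (2 * lam + 2 * p.1) p.2

lemma gegenbauer_zero (lam w : ℝ) : gegenbauer lam 0 w = 1 := by simp [gegenbauer, coeff_zero]

/-- Summing over `p.2` with the binomial series leaves a binomial series in
`4 w s / (1 - s) ^ 2`, which the bound on `s` keeps below `1`. -/
lemma summable_gegenbauer_terms {lam : ℝ} (hlam : 0 < lam) {w s : ℝ} (hw : 0 ≤ w) (hs : 0 ≤ s)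
    (h : s * (16 * w + 4) ≤ 1) :
    Summable (fun p : ℕ × ℕ =>
      coeff lam p.1 * (4 * w) ^ p.1 * coeff (2 * lam + 2 * p.1) p.2 * s ^ (p.1 + p.2)) := by
  have hs4 : s ≤ 1 / 4 := by nlinarith [mul_nonneg hs hw]
  have hsw : s * w ≤ 1 / 16 := by nlinarith
  have hpos : (0 : ℝ) < 1 - s := by linarith
  have hrow : ∀ k : ℕ, HasSum (fun m : ℕ =>
      coeff lam k * (4 * w) ^ k * coeff (2 * lam + 2 * k) m * s ^ (k + m))
      ((1 - s) ^ (-(2 * lam)) * (coeff lam k * (4 * w * s / (1 - s) ^ 2) ^ k)) := by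
    intro k
    have h1 := (hasSum_coeff_real (2 * lam + 2 * k) hs (by linarith)).mul_left
      (coeff lam k * (4 * w) ^ k * s ^ k)
    convert! h1 using 1
    · funext m; rw [pow_add]; ring
    · rw [show -(2 * lam + 2 * (k : ℝ)) = -(2 * lam) - ((2 * k : ℕ) : ℝ) by push_cast; ring,
        Real.rpow_sub hpos, Real.rpow_natCast, div_pow, mul_pow (4 * w) s, ← pow_mul]
      ring
  rw [summable_prod_of_nonneg]
  · refine ⟨fun k => (hrow k).summable, ?_⟩
    simp only [fun k : ℕ => (hrow k).tsum_eq]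
    refine (hasSum_coeff_real lam (by positivity) ?_).summable.mul_left _
    rw [div_lt_one (by positivity)]
    nlinarith
  · rintro ⟨k, m⟩
    have := (coeff_pos hlam k).le
    have := (coeff_pos (show 0 < 2 * lam + 2 * (k : ℝ) by positivity) m).le
    simp only [Pi.zero_apply]
    positivity

/-- The generating function of the Gegenbauer polynomials, from
`1 - 2 y s + s ^ 2 = (1 - s) ^ 2 (1 - 4 w s / (1 - s) ^ 2)` by expanding both factors.
The bound on `s` ensures `‖4 w s / (1 - s) ^ 2‖ < 1` and keeps the bases in the right half plane,
where principal powers are multiplicative. -/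
theorem hasSum_gegenbauer {lam : ℝ} (hlam : 0 < lam) (w : ℝ) {s : ℂ}
    (h : ‖s‖ * (16 * |w| + 4) ≤ 1) :
    HasSum (fun n => (gegenbauer lam n w : ℂ) * s ^ n)
      ((1 - 2 * (2 * w + 1) * s + s ^ 2) ^ (-(lam : ℂ))) := by
  have hs4 : ‖s‖ ≤ 1 / 4 := by nlinarith [mul_nonneg (norm_nonneg s) (abs_nonneg w)]
  have hsw : ‖s‖ * |w| ≤ 1 / 16 := by nlinarith [norm_nonneg s]
  have hne : (1 - s) ≠ 0 := by
    intro h0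
    have : s = 1 := (sub_eq_zero.1 h0).symm
    rw [this, norm_one] at hs4
    norm_num at hs4
  set v : ℂ := 4 * w * s / (1 - s) ^ 2 with hv
  have hlow : (3 / 4 : ℝ) ≤ ‖1 - s‖ := by
    have := norm_sub_norm_le (1 : ℂ) s
    rw [norm_one] at this
    linarith
  have hv1 : ‖v‖ < 1 := by
    rw [hv, norm_div, norm_pow, div_lt_one (by positivity)]
    simp only [norm_mul, Complex.norm_real, Real.norm_eq_abs, Complex.norm_ofNat]
    nlinarith
  set T : ℕ × ℕ → ℂ := fun p =>
    (coeff lam p.1 * (4 * w) ^ p.1 * coeff (2 * lam + 2 * p.1) p.2 : ℝ) * s ^ (p.1 + p.2) with hT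
  have hsum : Summable T := by
    refine Summable.of_norm ?_
    convert! summable_gegenbauer_terms hlam (abs_nonneg w) (norm_nonneg s) h using 2 with p
    have h1 := (coeff_pos hlam p.1).le
    have h2 := (coeff_pos (show 0 < 2 * lam + 2 * (p.1 : ℝ) by positivity) p.2).le
    rw [hT]
    simp only [norm_mul, norm_pow, Complex.norm_real, Real.norm_eq_abs,
      abs_of_nonneg h1, abs_of_nonneg h2]
    norm_num
  have hrow : ∀ k : ℕ, HasSum (fun m => T (k, m))
      ((1 - s) ^ (-(2 * lam : ℂ)) * (coeff lam k * v ^ k)) := by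
    intro k
    have h1 := (hasSum_coeff (2 * lam + 2 * k) (s := s) (by linarith)).mul_left
      (coeff lam k * (4 * w) ^ k * s ^ k : ℂ)
    convert! h1 using 1
    · funext m; simp only [hT, pow_add]; push_cast; ring
    · push_cast
      rw [show -(2 * (lam : ℂ) + 2 * (k : ℂ)) = -(2 * lam) - ((2 * k : ℕ) : ℂ) by push_cast; ring,
        Complex.cpow_sub _ _ hne, Complex.cpow_natCast, hv, div_pow, mul_pow (4 * (w : ℂ)) s,
        ← pow_mul]
      ring
  have htot : HasSum T ((1 - s) ^ (-(2 * lam : ℂ)) * (1 - v) ^ (-(lam : ℂ))) := by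
    have h1 := hsum.hasSum.prod_fiberwise hrow
    have h2 := (hasSum_coeff lam hv1).mul_left ((1 - s) ^ (-(2 * lam : ℂ)))
    rw [h2.unique h1]
    exact hsum.hasSum
  have hanti : HasSum (fun n => ∑ p ∈ Finset.HasAntidiagonal.antidiagonal n, T p)
      ((1 - s) ^ (-(2 * lam : ℂ)) * (1 - v) ^ (-(lam : ℂ))) := by
    have h1 := (Finset.HasAntidiagonal.sigmaAntidiagonalEquivProd (A := ℕ)).hasSum_iff.2 htot
    refine h1.sigma (fun n => ?_)
    have h3 := hasSum_fintype
      (fun q : Finset.HasAntidiagonal.antidiagonal n => T (q : ℕ × ℕ))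
    rw [Finset.sum_coe_sort (Finset.HasAntidiagonal.antidiagonal n) T] at h3
    exact h3
  convert! hanti using 1
  · funext n
    rw [gegenbauer, Complex.ofReal_sum, Finset.sum_mul]
    refine Finset.sum_congr rfl fun p hp => ?_
    rw [hT, ← Finset.HasAntidiagonal.mem_antidiagonal.1 hp]
  · have hre1 : 0 < (1 - s).re := re_pos_of_norm_sub_one_lt (by
      rw [show (1 - s) - 1 = -s by ring, norm_neg]; linarith)
    have hre2 : 0 < ((1 - s) * (1 - s)).re := re_pos_of_norm_sub_one_lt (by
      rw [show (1 - s) * (1 - s) - 1 = s * s - 2 * s by ring]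
      refine (norm_sub_le _ _).trans_lt ?_
      rw [norm_mul, norm_mul, Complex.norm_ofNat]
      nlinarith [norm_nonneg s])
    have hre3 : 0 < (1 - v).re := re_pos_of_norm_sub_one_lt (by
      rw [show (1 - v) - 1 = -v by ring, norm_neg]; exact hv1)
    have hpoly : 1 - 2 * (2 * (w : ℂ) + 1) * s + s ^ 2 = (1 - s) * (1 - s) * (1 - v) := by
      rw [hv]; field_simp; ring
    rw [hpoly, mul_cpow_of_re_pos hre2 hre3, mul_cpow_of_re_pos hre1 hre1,
      ← Complex.cpow_add _ _ hne]
    congr 2; ring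

/-- For `|w| ≤ 1` the values are dominated by those at `w = 1`, since all coefficients in powers of
`w` are positive. -/
lemma abs_gegenbauer_le {lam : ℝ} (hlam : 0 < lam) (n : ℕ) {w : ℝ} (hw : |w| ≤ 1) :
    |gegenbauer lam n w| ≤ gegenbauer lam n 1 := by
  refine (Finset.abs_sum_le_sum_abs _ _).trans (Finset.sum_le_sum fun p _ => ?_)
  have h1 := (coeff_pos hlam p.1).le
  have h2 := (coeff_pos (show 0 < 2 * lam + 2 * (p.1 : ℝ) by positivity) p.2).le
  rw [abs_mul, abs_mul, abs_of_nonneg h1, abs_of_nonneg h2, abs_pow, abs_mul]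
  norm_num
  gcongr
  linarith

/-! ### Jacobi polynomials as combinations of Gegenbauer polynomials -/

/-- The coefficients in the expansion of `(1 + eps s) (1 - 2 y s + s ^ 2) ^ (-lam)`. -/
noncomputable def gegenbauerComb (lam eps : ℝ) (w : ℝ) : ℕ → ℝ
  | 0 => 1
  | n + 1 => gegenbauer lam (n + 1) w + eps * gegenbauer lam n w

theorem hasSum_gegenbauerComb {lam : ℝ} (hlam : 0 < lam) (eps w : ℝ) {s : ℂ}
    (h : ‖s‖ * (16 * |w| + 4) ≤ 1) :
    HasSum (fun n => (gegenbauerComb lam eps w n : ℂ) * s ^ n)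
      ((1 + eps * s) * (1 - 2 * (2 * w + 1) * s + s ^ 2) ^ (-(lam : ℂ))) := by
  have h1 := hasSum_gegenbauer hlam w h
  have h2 := (hasSum_nat_add_iff' 1).2 h1
  have h3 := (h2.add (h1.mul_left (eps * s)))
  rw [← hasSum_nat_add_iff' 1]
  convert! h3 using 1
  · funext n
    simp only [gegenbauerComb]
    push_cast
    ring
  · simp [gegenbauerComb, gegenbauer_zero]
    ring

lemma eval_ascPochhammer_add (x : ℝ) (m n : ℕ) :
    (ascPochhammer ℝ (m + n)).eval x =
      (ascPochhammer ℝ m).eval x * (ascPochhammer ℝ n).eval (x + m) := by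
  rw [← ascPochhammer_mul, Polynomial.eval_mul, Polynomial.eval_comp]
  simp

lemma eval_ascPochhammer_succ_left (x : ℝ) (n : ℕ) :
    (ascPochhammer ℝ (n + 1)).eval x = x * (ascPochhammer ℝ n).eval (x + 1) := by
  rw [add_comm, eval_ascPochhammer_add]
  simp

/-- The duplication formula for rising factorials. -/
lemma eval_ascPochhammer_two_mul (x : ℝ) (m : ℕ) :
    (ascPochhammer ℝ (2 * m)).eval x =
      4 ^ m * (ascPochhammer ℝ m).eval (x / 2) * (ascPochhammer ℝ m).eval (x / 2 + 1 / 2) := by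
  induction m with
  | zero => simp
  | succ m ih =>
    rw [show 2 * (m + 1) = 2 * m + 1 + 1 by ring]
    simp only [ascPochhammer_succ_eval, ih]
    push_cast
    ring

/-- The coefficients of `(1 + eps s) (1 - s) ^ (-2 c)` for `eps = ±1`, in product form. The two
signs are the two ways of applying the duplication formula. -/
lemma factorial_mul_coeff_comb {eps : ℝ} (heps : eps = 1 ∨ eps = -1) (c : ℝ) (m : ℕ) :
    ((m + 1)! : ℝ) * (coeff (2 * c) (m + 1) + eps * coeff (2 * c) m)
        * (ascPochhammer ℝ (m + 1)).eval (2 * c + m)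
      = 4 ^ (m + 1) * (ascPochhammer ℝ (m + 1)).eval c
        * (ascPochhammer ℝ (m + 1)).eval (c + eps / 2) := by
  have hf : (m ! : ℝ) ≠ 0 := by positivity
  have h0 : ((m + 1)! : ℝ) * (coeff (2 * c) (m + 1) + eps * coeff (2 * c) m)
      = (ascPochhammer ℝ m).eval (2 * c) * (2 * c + m + eps * (m + 1)) := by
    rw [coeff, coeff, ascPochhammer_succ_eval, Nat.factorial_succ]
    push_cast
    field_simp
  rw [h0]
  rcases heps with rfl | rfl
  · have h1 := eval_ascPochhammer_two_mul (2 * c) (m + 1)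
    rw [show 2 * (m + 1) = m + (m + 1) + 1 by ring, ascPochhammer_succ_eval,
      eval_ascPochhammer_add, show 2 * c / 2 = c by ring] at h1
    rw [← h1]
    push_cast
    ring
  · have h1 := eval_ascPochhammer_two_mul (2 * c - 1) (m + 1)
    rw [show 2 * (m + 1) = m + (m + 1) + 1 by ring, eval_ascPochhammer_succ_left,
      sub_add_cancel, eval_ascPochhammer_add, show (2 * c - 1) / 2 = c + -1 / 2 by ring,
      show c + -1 / 2 + 1 / 2 = c by ring] at h1
    rw [mul_right_comm (4 ^ (m + 1)), ← h1]
    ring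

lemma eval_monicJacobi (a b : ℝ) (n : ℕ) (w : ℝ) :
    (monicJacobi a b n).eval (2 * w + 1) =
      2 ^ n * (n ! : ℝ) / (ascPochhammer ℝ n).eval ((n : ℝ) + a + b + 1) *
      ∑ k ∈ Finset.range (n + 1), ((n.choose k : ℝ) / (n ! : ℝ)
        * (ascPochhammer ℝ k).eval ((n : ℝ) + a + b + 1)
        * (ascPochhammer ℝ (n - k)).eval (a + (k : ℝ) + 1)) * w ^ k := by
  simp only [monicJacobi, jacobi, Polynomial.eval_mul, Polynomial.eval_C,
    Polynomial.eval_finsetSum, Polynomial.eval_pow, Polynomial.eval_sub, Polynomial.eval_X,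
    Polynomial.eval_one]
  simp

/-- Up to normalization, `C_n^{lam} + eps C_{n-1}^{lam}` is the Jacobi polynomial with parameters
`lam - 1 + eps / 2` and `lam - 1 - eps / 2`: the coefficients in powers of `w` agree. -/
theorem coeff_mul_eval_monicJacobi {lam eps : ℝ} (hlam : 1 / 2 < lam) (heps : eps = 1 ∨ eps = -1)
    (n : ℕ) (w : ℝ) :
    coeff lam n * 2 ^ n *
      (monicJacobi (lam - 1 + eps / 2) (lam - 1 - eps / 2) n).eval (2 * w + 1)
      = gegenbauerComb lam eps w n := by
  rcases n with _ | N
  · simp [monicJacobi, jacobi, gegenbauerComb, coeff_zero]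
  set n := N + 1 with hn
  have hq : (0 : ℝ) < 2 * lam + N := by
    have : (0 : ℝ) ≤ N := Nat.cast_nonneg N
    linarith
  have key : ∀ p ∈ Finset.HasAntidiagonal.antidiagonal n,
      coeff lam n * 2 ^ n * (2 ^ n * (n ! : ℝ) / (ascPochhammer ℝ n).eval (2 * lam + N) *
        (((n.choose p.1 : ℝ) / (n ! : ℝ) * (ascPochhammer ℝ p.1).eval (2 * lam + N)
          * (ascPochhammer ℝ p.2).eval (lam + eps / 2 + (p.1 : ℝ))) * w ^ p.1)) =
      coeff lam p.1 * (4 * w) ^ p.1 * (coeff (2 * lam + 2 * p.1) p.2 +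
        eps * (if p.2 = 0 then 0 else coeff (2 * lam + 2 * p.1) (p.2 - 1))) := by
    rintro ⟨k, m⟩ hp
    have hkm : k + m = n := Finset.HasAntidiagonal.mem_antidiagonal.1 hp
    simp only
    have h1 : (n.choose k : ℝ) = n ! / (k ! * m !) := by
      rw [← hkm, Nat.choose_symm_add, Nat.add_choose,
        Nat.cast_div (Nat.factorial_mul_factorial_dvd_factorial_add k m) (by positivity)]
      push_cast; rfl
    have h2 : (ascPochhammer ℝ n).eval lam =
        (ascPochhammer ℝ k).eval lam * (ascPochhammer ℝ m).eval (lam + k) := by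
      rw [← hkm, eval_ascPochhammer_add]
    have h3 : (ascPochhammer ℝ n).eval (2 * lam + N) =
        (ascPochhammer ℝ k).eval (2 * lam + N) * (ascPochhammer ℝ m).eval (2 * lam + N + k) := by
      rw [← hkm, eval_ascPochhammer_add]
    have hk0 := (ascPochhammer_pos k _ hq).ne'
    have hm0 := (ascPochhammer_pos m (2 * lam + N + k) (by positivity)).ne'
    have hfk : (k ! : ℝ) ≠ 0 := by positivity
    have hfm : (m ! : ℝ) ≠ 0 := by positivity
    have hfn : (n ! : ℝ) ≠ 0 := by positivity
    have h5 : (m ! : ℝ) * (coeff (2 * lam + 2 * k) m +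
        eps * (if m = 0 then 0 else coeff (2 * lam + 2 * k) (m - 1)))
          * (ascPochhammer ℝ m).eval (2 * lam + N + k)
        = 4 ^ m * (ascPochhammer ℝ m).eval (lam + k)
          * (ascPochhammer ℝ m).eval (lam + eps / 2 + k) := by
      rcases m with _ | M
      · simp [coeff_zero]
      · have hNk : (N : ℝ) = k + M := by
          have : k + M = N := by omega
          rw [← this]; push_cast; ring
        have := factorial_mul_coeff_comb heps (lam + k) M
        rw [show 2 * (lam + (k : ℝ)) = 2 * lam + 2 * k by ring] at this
        rw [if_neg (Nat.succ_ne_zero M), Nat.add_sub_cancel,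
          show 2 * lam + N + k = 2 * lam + 2 * k + M by rw [hNk]; ring,
          show lam + eps / 2 + k = lam + k + eps / 2 by ring, this]
    have h4 : (4 : ℝ) ^ m * 4 ^ k = 2 ^ n * 2 ^ n := by
      rw [← pow_add, ← mul_pow, add_comm, hkm]; norm_num
    rw [coeff, coeff, h1, h2, h3, mul_pow]
    generalize coeff (2 * lam + 2 * ↑k) m +
      eps * (if m = 0 then 0 else coeff (2 * lam + 2 * ↑k) (m - 1)) = E at *
    generalize (ascPochhammer ℝ k).eval (2 * lam + N) = A1 at *
    generalize (ascPochhammer ℝ m).eval (2 * lam + N + k) = A2 at *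
    generalize (ascPochhammer ℝ m).eval (lam + eps / 2 + k) = A3 at *
    generalize (ascPochhammer ℝ m).eval (lam + (k : ℝ)) = A4 at *
    generalize (ascPochhammer ℝ k).eval lam = A5 at *
    field_simp
    linear_combination A5 * w ^ k * ((-A4 * A3) * h4 - 4 ^ k * h5)
  rw [eval_monicJacobi, show ((n : ℕ) : ℝ) + (lam - 1 + eps / 2) + (lam - 1 - eps / 2) + 1
    = 2 * lam + N by rw [hn]; push_cast; ring, Finset.mul_sum, Finset.mul_sum,
    ← Finset.Nat.sum_antidiagonal_eq_sum_range_succ (fun k m => coeff lam n * 2 ^ n *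
      (2 ^ n * (n ! : ℝ) / (ascPochhammer ℝ n).eval (2 * lam + N) *
        (((n.choose k : ℝ) / (n ! : ℝ) * (ascPochhammer ℝ k).eval (2 * lam + N)
          * (ascPochhammer ℝ m).eval (lam - 1 + eps / 2 + (k : ℝ) + 1)) * w ^ k)))]
  have hrw : ∀ k : ℕ, lam - 1 + eps / 2 + (k : ℝ) + 1 = lam + eps / 2 + k := fun k => by ring
  simp only [hrw]
  rw [Finset.sum_congr rfl key]
  simp only [mul_add, Finset.sum_add_distrib]
  rw [hn, gegenbauerComb, gegenbauer, gegenbauer]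
  congr 1
  rw [Finset.Nat.antidiagonal_succ', Finset.sum_cons, Finset.sum_map, Finset.mul_sum]
  simp only [if_true, mul_zero, zero_add]
  refine Finset.sum_congr rfl fun p _ => ?_
  simp
  ring

/-! ### Orthogonal polynomials -/

lemma integrable_eval {μ : Measure ℝ} (hm : ∀ n : ℕ, Integrable (fun x : ℝ => x ^ n) μ)
    (q : ℝ[X]) : Integrable (fun x => q.eval x) μ := by
  simp only [Polynomial.eval_eq_sum_range]
  exact integrable_finsetSum _ fun i _ => (hm i).const_mul _

/-- The moment functional of `μ` on polynomials. -/
noncomputable def momentFunctional (μ : Measure ℝ) (q : ℝ[X]) : ℝ := ∫ x, q.eval x ∂μ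

section momentFunctional

variable {μ : Measure ℝ}

lemma momentFunctional_add (hm : ∀ n : ℕ, Integrable (fun x : ℝ => x ^ n) μ) (p q : ℝ[X]) :
    momentFunctional μ (p + q) = momentFunctional μ p + momentFunctional μ q := by
  simp only [momentFunctional, Polynomial.eval_add]
  exact integral_add (integrable_eval hm p) (integrable_eval hm q)

lemma momentFunctional_sub (hm : ∀ n : ℕ, Integrable (fun x : ℝ => x ^ n) μ) (p q : ℝ[X]) :
    momentFunctional μ (p - q) = momentFunctional μ p - momentFunctional μ q := by
  simp only [momentFunctional, Polynomial.eval_sub]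
  exact integral_sub (integrable_eval hm p) (integrable_eval hm q)

lemma momentFunctional_C_mul (c : ℝ) (q : ℝ[X]) :
    momentFunctional μ (Polynomial.C c * q) = c * momentFunctional μ q := by
  simp only [momentFunctional, Polynomial.eval_mul, Polynomial.eval_C]
  exact integral_const_mul _ _

lemma momentFunctional_congr_ae {p q : ℝ[X]} (h : ∀ᵐ x ∂μ, p.eval x = q.eval x) :
    momentFunctional μ p = momentFunctional μ q := integral_congr_ae h

lemma momentFunctional_one [IsProbabilityMeasure μ] : momentFunctional μ 1 = 1 := by
  simp [momentFunctional]

end momentFunctional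

/-- Subtracting the multiple of `P n` with the right leading coefficient lowers the degree. -/
lemma degree_sub_C_mul_lt {p q : ℝ[X]} {n : ℕ} (hp : p.Monic) (hn : p.natDegree = n)
    (hq : q.degree < ((n + 1 : ℕ) : WithBot ℕ)) :
    (q - Polynomial.C (q.coeff n) * p).degree < (n : WithBot ℕ) := by
  rw [Polynomial.degree_lt_iff_coeff_zero] at hq ⊢
  intro m hm
  rw [Polynomial.coeff_sub, Polynomial.coeff_C_mul]
  rcases hm.eq_or_lt with rfl | h
  · rw [show p.coeff n = 1 by rw [← hn]; exact hp.coeff_natDegree]; ring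
  · rw [hq m h, Polynomial.coeff_eq_zero_of_natDegree_lt (p := p) (by omega)]; ring

/-- A polynomial orthogonal to the first `n` members of a monic family is orthogonal to all
polynomials of degree less than `n`. -/
lemma momentFunctional_mul_eq_zero {μ : Measure ℝ} {P : ℕ → ℝ[X]}
    (hm : ∀ n : ℕ, Integrable (fun x : ℝ => x ^ n) μ) (hmon : ∀ n, (P n).Monic)
    (hdeg : ∀ n, (P n).natDegree = n) (d : ℝ[X]) (n : ℕ)
    (h : ∀ k < n, momentFunctional μ (d * P k) = 0) (q : ℝ[X]) (hq : q.degree < (n : WithBot ℕ)) :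
    momentFunctional μ (d * q) = 0 := by
  induction n generalizing q with
  | zero =>
    have : q = 0 := by simpa using hq
    simp [this, momentFunctional]
  | succ n ih =>
    have h1 := ih (fun k hk => h k (by omega)) _ (degree_sub_C_mul_lt (hmon n) (hdeg n) hq)
    have h2 : d * q = d * (q - Polynomial.C (q.coeff n) * P n)
        + Polynomial.C (q.coeff n) * (d * P n) := by ring
    rw [h2, momentFunctional_add hm, h1, momentFunctional_C_mul, h n (by omega)]
    ring

section IsMonicOPS

variable {μ : Measure ℝ} {P : ℕ → ℝ[X]}

lemma IsMonicOPS.momentFunctional_eq_zero (hP : IsMonicOPS μ P) {m n : ℕ} (h : m ≠ n) :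
    momentFunctional μ (P m * P n) = 0 := by
  simpa [momentFunctional] using hP.orthogonal m n h

lemma IsMonicOPS.zero_eq_one (hP : IsMonicOPS μ P) : P 0 = 1 :=
  (Polynomial.Monic.natDegree_eq_zero (hP.monic 0)).1 (hP.degree 0)

lemma IsMonicOPS.orthogonal_of_degree_lt (hP : IsMonicOPS μ P)
    (hm : ∀ n : ℕ, Integrable (fun x : ℝ => x ^ n) μ) (n : ℕ) {q : ℝ[X]}
    (hq : q.degree < (n : WithBot ℕ)) : momentFunctional μ (P n * q) = 0 :=
  momentFunctional_mul_eq_zero hm hP.monic hP.degree _ n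
    (fun _ hk => hP.momentFunctional_eq_zero hk.ne') q hq

lemma IsMonicOPS.degree_X_mul_sub (hP : IsMonicOPS μ P) (n : ℕ) :
    (Polynomial.X * P n - P (n + 1)).degree < ((n + 1 : ℕ) : WithBot ℕ) := by
  have h1 := degree_sub_C_mul_lt (q := Polynomial.X * P n) (hP.monic (n + 1)) (hP.degree (n + 1))
    (by
      refine Polynomial.degree_lt_iff_coeff_zero _ _ |>.2 fun m hm => ?_
      rcases m with _ | m
      · simp
      · rw [Polynomial.coeff_X_mul, Polynomial.coeff_eq_zero_of_natDegree_lt]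
        rw [hP.degree]; omega)
  have h2 : (P n).coeff n = 1 := by
    have := (hP.monic n).coeff_natDegree
    rwa [hP.degree] at this
  rwa [Polynomial.coeff_X_mul, h2, map_one, one_mul] at h1

lemma IsMonicOPS.degree_X_mul_lt (hP : IsMonicOPS μ P) {k n : ℕ} (h : k < n) :
    (Polynomial.X * P k).degree < ((n + 1 : ℕ) : WithBot ℕ) := by
  refine Polynomial.degree_lt_iff_coeff_zero _ _ |>.2 fun m hm => ?_
  rcases m with _ | m
  · simp
  · rw [Polynomial.coeff_X_mul, Polynomial.coeff_eq_zero_of_natDegree_lt]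
    rw [hP.degree]; omega

lemma IsMonicOPS.momentFunctional_X_mul (hP : IsMonicOPS μ P)
    (hm : ∀ n : ℕ, Integrable (fun x : ℝ => x ^ n) μ) (n : ℕ) :
    momentFunctional μ (P (n + 1) * (Polynomial.X * P n)) =
      momentFunctional μ (P (n + 1) * P (n + 1)) := by
  have h := hP.orthogonal_of_degree_lt hm (n + 1) (hP.degree_X_mul_sub n)
  rw [mul_sub, momentFunctional_sub hm] at h
  linarith

/-- Favard's three-term recurrence: monic orthogonal polynomials of a measure that is positive
definite on polynomials have Jacobi–Szegő parameters, with positive `ω`. -/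
theorem IsMonicOPS.exists_isJacobiSzego (hP : IsMonicOPS μ P)
    (hm : ∀ n : ℕ, Integrable (fun x : ℝ => x ^ n) μ)
    (hpos : ∀ q : ℝ[X], q ≠ 0 → 0 < momentFunctional μ (q * q)) :
    ∃ α ω : ℕ → ℝ, IsJacobiSzego P α ω ∧ ∀ n, 0 < ω n := by
  set N : ℕ → ℝ := fun n => momentFunctional μ (P n * P n) with hN
  have hNpos : ∀ n, 0 < N n := fun n => hpos _ (hP.monic n).ne_zero
  set α : ℕ → ℝ := fun n => momentFunctional μ (P n * (Polynomial.X * P n)) / N n with hα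
  set ω : ℕ → ℝ := fun n => if n = 0 then 1 else N n / N (n - 1) with hω
  have hzero : ∀ d : ℝ[X], ∀ n : ℕ, d.degree < (n : WithBot ℕ) →
      (∀ k < n, momentFunctional μ (d * P k) = 0) → d = 0 := by
    intro d n hd h
    by_contra hne
    exact (hpos d hne).ne' (momentFunctional_mul_eq_zero hm hP.monic hP.degree d n h d hd)
  have hdegP : ∀ {k n : ℕ}, k < n → (P k).degree < (n : WithBot ℕ) := by
    intro k n h
    rw [Polynomial.degree_eq_natDegree (hP.monic k).ne_zero, hP.degree]
    exact_mod_cast h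
  have hdegC : ∀ (c : ℝ) {k n : ℕ}, k < n →
      (Polynomial.C c * P k).degree < (n : WithBot ℕ) := fun c k n h =>
    by
    rw [← Polynomial.smul_eq_C_mul]
    exact (Polynomial.degree_smul_le _ _).trans_lt (hdegP h)
  refine ⟨α, ω, ⟨by simp [hω], ?_, fun n => ?_⟩, fun n => ?_⟩
  · rw [← sub_eq_zero]
    refine hzero _ 1 ?_ fun k hk => ?_
    · rw [← sub_sub]
      exact (Polynomial.degree_sub_le _ _).trans_lt
        (max_lt (hP.degree_X_mul_sub 0) (hdegC _ zero_lt_one))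
    · obtain rfl : k = 0 := by omega
      have e : (Polynomial.X * P 0 - (P 1 + Polynomial.C (α 0) * P 0)) * P 0 =
          P 0 * (Polynomial.X * P 0) - P 1 * P 0 - Polynomial.C (α 0) * (P 0 * P 0) := by ring
      rw [e, momentFunctional_sub hm, momentFunctional_sub hm, momentFunctional_C_mul,
        hP.momentFunctional_eq_zero one_ne_zero, sub_zero]
      simp only [hα]
      rw [div_mul_cancel₀ _ (hNpos 0).ne', sub_self]
  · rw [← sub_eq_zero]
    refine hzero _ (n + 2) ?_ fun k hk => ?_
    · rw [← sub_sub, ← sub_sub]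
      exact (Polynomial.degree_sub_le _ _).trans_lt (max_lt ((Polynomial.degree_sub_le _ _).trans_lt
        (max_lt (hP.degree_X_mul_sub (n + 1)) (hdegC _ (by omega)))) (hdegC _ (by omega)))
    · have e : (Polynomial.X * P (n + 1) - (P (n + 2) + Polynomial.C (α (n + 1)) * P (n + 1) +
          Polynomial.C (ω (n + 1)) * P n)) * P k =
          P (n + 1) * (Polynomial.X * P k) - P (n + 2) * P k
            - Polynomial.C (α (n + 1)) * (P (n + 1) * P k)
            - Polynomial.C (ω (n + 1)) * (P n * P k) := by ring
      rw [e, momentFunctional_sub hm, momentFunctional_sub hm, momentFunctional_sub hm,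
        momentFunctional_C_mul, momentFunctional_C_mul,
        hP.momentFunctional_eq_zero (show n + 2 ≠ k by omega), sub_zero]
      rcases Nat.lt_trichotomy k n with h | h | h
      · rw [hP.orthogonal_of_degree_lt hm (n + 1) (hP.degree_X_mul_lt h),
          hP.momentFunctional_eq_zero (show n + 1 ≠ k by omega),
          hP.momentFunctional_eq_zero (show n ≠ k by omega)]
        ring
      · subst h
        rw [hP.momentFunctional_eq_zero (show k + 1 ≠ k by omega),
          hP.momentFunctional_X_mul hm]
        simp only [hω, Nat.add_eq_zero_iff, one_ne_zero, and_false, if_false, Nat.add_sub_cancel]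
        rw [div_mul_cancel₀ _ (hNpos k).ne']
        simp only [hN]
        ring
      · obtain rfl : k = n + 1 := by omega
        rw [hP.momentFunctional_eq_zero (show n ≠ n + 1 by omega)]
        simp only [hα]
        rw [div_mul_cancel₀ _ (hNpos _).ne']
        ring
  · rcases n with _ | n
    · simp [hω]
    · simp only [hω, Nat.add_eq_zero_iff, one_ne_zero, and_false, if_false]
      exact div_pos (hNpos _) (hNpos _)

/-- If the monic orthogonal polynomials of `μ` agree `μ`-almost everywhere with a family
`p` obeying a three-term recurrence with positive `ω`, then they are equal to `p`. This needs an
argument because `μ` is not assumed to have infinite support: that follows from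
`‖P (n + 1)‖² = ω (n + 1) ‖P n‖² > 0`. -/
theorem IsMonicOPS.eq_of_ae_eq [IsProbabilityMeasure μ] (hP : IsMonicOPS μ P)
    (hm : ∀ n : ℕ, Integrable (fun x : ℝ => x ^ n) μ) {p : ℕ → ℝ[X]} {α ω : ℕ → ℝ}
    (hp : IsJacobiSzego p α ω) (hω : ∀ n, 0 < ω n)
    (hae : ∀ n, ∀ᵐ x ∂μ, (P n).eval x = (p n).eval x) (n : ℕ) :
    P n = p n := by
  have hpos : ∀ n, 0 < momentFunctional μ (P n * P n) := by
    intro n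
    induction n with
    | zero => rw [hP.zero_eq_one, one_mul, momentFunctional_one]; exact one_pos
    | succ n ih =>
      have h1 : momentFunctional μ (P (n + 1) * (Polynomial.X * P n)) =
          momentFunctional μ ((P (n + 2) * P n + Polynomial.C (α (n + 1)) * (P (n + 1) * P n))
            + Polynomial.C (ω (n + 1)) * (P n * P n)) := by
        refine momentFunctional_congr_ae ?_
        filter_upwards [hae n, hae (n + 1), hae (n + 2)] with x h0 h1 h2
        have h3 := congrArg (Polynomial.eval x) (hp.rec_succ n)
        simp only [Polynomial.eval_mul, Polynomial.eval_add, Polynomial.eval_X,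
          Polynomial.eval_C] at h3 ⊢
        rw [h1, h2, h0]
        linear_combination (p n).eval x * h3
      rw [← hP.momentFunctional_X_mul hm, h1, momentFunctional_add hm, momentFunctional_add hm,
        momentFunctional_C_mul, momentFunctional_C_mul,
        hP.momentFunctional_eq_zero (show n + 2 ≠ n by omega),
        hP.momentFunctional_eq_zero (show n + 1 ≠ n by omega)]
      simpa using mul_pos (hω (n + 1)) ih
  rw [← sub_eq_zero]
  by_contra hne
  -- if `D ≠ 0`, then `D / (leading coefficient) - P (deg D)` has lower degree, so orthogonality to
  -- `P (deg D)` and `D = 0` almost everywhere give `‖P (deg D)‖ = 0`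
  set D := P n - p n with hD
  have hdegD : D.degree < ((D.natDegree + 1 : ℕ) : WithBot ℕ) := by
    rw [Polynomial.degree_eq_natDegree hne]
    exact_mod_cast Nat.lt_succ_self _
  have h1 := hP.orthogonal_of_degree_lt hm D.natDegree
    (degree_sub_C_mul_lt (hP.monic D.natDegree) (hP.degree D.natDegree) hdegD)
  have h2 : momentFunctional μ (P D.natDegree * D) = 0 := by
    rw [show (0 : ℝ) = momentFunctional μ 0 by simp [momentFunctional]]
    refine momentFunctional_congr_ae ?_
    filter_upwards [hae n] with x hx
    simp [hD, hx]
  rw [mul_sub, momentFunctional_sub hm, h2, mul_left_comm, momentFunctional_C_mul] at h1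
  have h3 := mul_ne_zero (Polynomial.leadingCoeff_ne_zero.2 hne) (hpos D.natDegree).ne'
  rw [Polynomial.leadingCoeff] at h3
  exact h3 (by linarith)

end IsMonicOPS

/-- Two probability measures with a common sequence of monic orthogonal polynomials have the same
moment functional. -/
lemma IsMonicOPS.momentFunctional_eq {μ ν : Measure ℝ} [IsProbabilityMeasure μ]
    [IsProbabilityMeasure ν] {P : ℕ → ℝ[X]}
    (hm : ∀ n : ℕ, Integrable (fun x : ℝ => x ^ n) μ)
    (hn : ∀ n : ℕ, Integrable (fun x : ℝ => x ^ n) ν)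
    (hP : IsMonicOPS μ P) (hQ : IsMonicOPS ν P) (q : ℝ[X]) :
    momentFunctional μ q = momentFunctional ν q := by
  have h : ∀ n : ℕ, ∀ q : ℝ[X], q.degree < (n : WithBot ℕ) →
      momentFunctional μ q = momentFunctional ν q := by
    intro n
    induction n with
    | zero =>
      intro q hq
      have : q = 0 := by simpa using hq
      simp [this, momentFunctional]
    | succ n ih =>
      intro q hq
      have h1 := ih _ (degree_sub_C_mul_lt (hP.monic n) (hP.degree n) hq)
      rw [momentFunctional_sub hm, momentFunctional_sub hn, momentFunctional_C_mul,
        momentFunctional_C_mul] at h1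
      have h2 : momentFunctional μ (P n) = momentFunctional ν (P n) := by
        rcases n with _ | n
        · rw [hP.zero_eq_one, momentFunctional_one, momentFunctional_one]
        · have h3 := hP.momentFunctional_eq_zero (Nat.succ_ne_zero n)
          have h4 := hQ.momentFunctional_eq_zero (Nat.succ_ne_zero n)
          rw [hP.zero_eq_one, mul_one] at h3 h4
          rw [h3, h4]
      rw [h2] at h1
      linarith
  refine h (q.natDegree + 1) q ?_
  exact (Polynomial.degree_le_natDegree).trans_lt (by exact_mod_cast Nat.lt_succ_self _)

/-- A probability measure is determined by its moments if they are those of a compactly supported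
probability measure `ν`: the growth of the even moments confines `μ` to a bounded interval, where
polynomials are dense in the continuous functions. -/
theorem eq_of_momentFunctional_eq {μ ν : Measure ℝ} [IsProbabilityMeasure μ]
    [IsProbabilityMeasure ν] {M : ℝ} (hM : 0 ≤ M) (hν : ∀ᵐ x ∂ν, |x| ≤ M)
    (hm : ∀ n : ℕ, Integrable (fun x : ℝ => x ^ n) μ)
    (hn : ∀ n : ℕ, Integrable (fun x : ℝ => x ^ n) ν)
    (h : ∀ q : ℝ[X], momentFunctional μ q = momentFunctional ν q) : μ = ν := by
  have hμ : ∀ᵐ x ∂μ, |x| ≤ M + 1 := by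
    have hbound : ∀ n : ℕ, μ.real {x | M + 1 ≤ |x|} ≤ ((M / (M + 1)) ^ 2) ^ n := by
      intro n
      have h1 := mul_meas_ge_le_integral_of_nonneg (μ := μ) (f := fun x : ℝ => x ^ (2 * n))
        (ae_of_all _ fun x => (even_two_mul n).pow_nonneg x) (hm _) ((M + 1) ^ (2 * n))
      have h2 : {x : ℝ | M + 1 ≤ |x|} ⊆ {x | (M + 1) ^ (2 * n) ≤ x ^ (2 * n)} := by
        intro x hx
        have := pow_le_pow_left₀ (by linarith) (show M + 1 ≤ |x| from hx) (2 * n)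
        rwa [pow_mul |x|, sq_abs, ← pow_mul] at this
      have h3 := h (Polynomial.X ^ (2 * n))
      simp only [momentFunctional, Polynomial.eval_pow, Polynomial.eval_X] at h3
      have h4 : ∫ x, x ^ (2 * n) ∂ν ≤ M ^ (2 * n) := by
        have h5 := integral_mono_ae (hn (2 * n)) (integrable_const (M ^ (2 * n))) (by
          filter_upwards [hν] with x hx
          have := pow_le_pow_left₀ (abs_nonneg x) hx (2 * n)
          rwa [pow_mul |x|, sq_abs, ← pow_mul] at this)
        simpa using h5
      have h5 := measureReal_mono (μ := μ) h2
      rw [← pow_mul, div_pow, le_div_iff₀ (by positivity)]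
      have h6 : (0 : ℝ) < (M + 1) ^ (2 * n) := by positivity
      nlinarith
    have hlt : (M / (M + 1)) ^ 2 < 1 := by
      rw [sq_lt_one_iff₀ (by positivity), div_lt_one (by positivity)]
      linarith
    have h0 : μ.real {x | M + 1 ≤ |x|} ≤ 0 :=
      ge_of_tendsto' (tendsto_pow_atTop_nhds_zero_of_lt_one (by positivity) hlt) hbound
    have h7 : μ {x | M + 1 ≤ |x|} = 0 := by
      have := le_antisymm h0 measureReal_nonneg
      rwa [measureReal_eq_zero_iff] at this
    rw [ae_iff]
    refine measure_mono_null (fun x hx => ?_) h7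
    exact (not_le.1 hx).le
  refine ext_of_forall_integral_eq_of_IsFiniteMeasure fun f => ?_
  have hfm : Integrable f μ := f.integrable μ
  have hfn : Integrable f ν := f.integrable ν
  refine eq_of_forall_dist_le fun ε hε => ?_
  rw [Real.dist_eq]
  obtain ⟨q, hq⟩ := exists_polynomial_near_of_continuousOn (-(M + 1)) (M + 1) f
    f.continuous.continuousOn (ε / 2) (half_pos hε)
  have key : ∀ ρ : Measure ℝ, IsProbabilityMeasure ρ → (∀ᵐ x ∂ρ, |x| ≤ M + 1) →
      (∀ n : ℕ, Integrable (fun x : ℝ => x ^ n) ρ) →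
      |∫ x, f x ∂ρ - momentFunctional ρ q| ≤ ε / 2 := by
    intro ρ _ hρ hr
    rw [momentFunctional, ← integral_sub (f.integrable ρ) (integrable_eval hr q)]
    have := norm_integral_le_of_norm_le_const (μ := ρ) (f := fun x => f x - q.eval x)
      (C := ε / 2) (by
        filter_upwards [hρ] with x hx
        rw [Real.norm_eq_abs, abs_sub_comm]
        exact (hq x (abs_le.1 hx)).le)
    simpa using this
  have h1 := key μ inferInstance hμ hm
  have h2 := key ν inferInstance (hν.mono fun x hx => by linarith) hn
  rw [h q] at h1
  rw [abs_le] at h1 h2 ⊢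
  constructor <;> linarith

/-! ### Beta distributions and Jacobi polynomials -/

lemma Gamma_add_natCast {x : ℝ} (hx : 0 < x) (n : ℕ) :
    Real.Gamma (x + n) = (ascPochhammer ℝ n).eval x * Real.Gamma x := by
  induction n with
  | zero => simp
  | succ n ih =>
    rw [Nat.cast_succ, ← add_assoc, Real.Gamma_add_one (by positivity), ih,
      ascPochhammer_succ_eval]
    ring

lemma ae_betaMeasure (α β : ℝ) : ∀ᵐ t ∂(ProbabilityTheory.betaMeasure α β), 0 < t ∧ t < 1 := by
  rw [ProbabilityTheory.betaMeasure, ae_withDensity_iff (by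
    unfold ProbabilityTheory.betaPDF; fun_prop)]
  refine ae_of_all _ fun t ht => ?_
  by_contra h
  simp [ProbabilityTheory.betaPDF_eq, h] at ht

lemma integrable_pow_betaMeasure {α β : ℝ} (hα : 0 < α) (hβ : 0 < β) (n : ℕ) :
    Integrable (fun t : ℝ => t ^ n) (ProbabilityTheory.betaMeasure α β) := by
  have := ProbabilityTheory.isProbabilityMeasureBeta hα hβ
  refine Integrable.of_bound (by fun_prop) 1 ?_
  filter_upwards [ae_betaMeasure α β] with t ht
  rw [norm_pow, Real.norm_eq_abs, abs_of_pos ht.1]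
  exact pow_le_one₀ ht.1.le ht.2.le

lemma betaPDFReal_nonneg {α β : ℝ} (hα : 0 < α) (hβ : 0 < β) (t : ℝ) :
    0 ≤ ProbabilityTheory.betaPDFReal α β t := by
  by_cases h : 0 < t ∧ t < 1
  · exact (ProbabilityTheory.betaPDFReal_pos h.1 h.2 hα hβ).le
  · simp [ProbabilityTheory.betaPDFReal, h]

lemma integral_betaPDFReal {α β : ℝ} (hα : 0 < α) (hβ : 0 < β) :
    ∫ t, ProbabilityTheory.betaPDFReal α β t = 1 := by
  rw [integral_eq_lintegral_of_nonneg_ae (ae_of_all _ (betaPDFReal_nonneg hα hβ))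
    (by fun_prop)]
  have := ProbabilityTheory.lintegral_betaPDF_eq_one hα hβ
  simp only [ProbabilityTheory.betaPDF] at this
  rw [this, ENNReal.toReal_one]

/-- The mixed moments of the Beta distribution. -/
theorem integral_pow_mul_pow_betaMeasure {α β : ℝ} (hα : 0 < α) (hβ : 0 < β) (j k : ℕ) :
    ∫ t, t ^ j * (1 - t) ^ k ∂(ProbabilityTheory.betaMeasure α β) =
      (ascPochhammer ℝ j).eval α * (ascPochhammer ℝ k).eval β
        / (ascPochhammer ℝ (j + k)).eval (α + β) := by
  have hj : 0 < α + j := by positivity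
  have hk : 0 < β + k := by positivity
  rw [ProbabilityTheory.betaMeasure, integral_withDensity_eq_integral_toReal_smul
    (f := ProbabilityTheory.betaPDF α β) (by unfold ProbabilityTheory.betaPDF; fun_prop)
    (ae_of_all _ fun t => ENNReal.ofReal_lt_top)]
  have h1 : ∀ t : ℝ, (ProbabilityTheory.betaPDF α β t).toReal • (t ^ j * (1 - t) ^ k) =
      (ProbabilityTheory.beta (α + j) (β + k) / ProbabilityTheory.beta α β) *
        ProbabilityTheory.betaPDFReal (α + j) (β + k) t := by
    intro t
    rw [ProbabilityTheory.betaPDF, ENNReal.toReal_ofReal (betaPDFReal_nonneg hα hβ t)]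
    by_cases h : 0 < t ∧ t < 1
    · have h2 : 0 < 1 - t := by linarith [h.2]
      have h3 := (ProbabilityTheory.beta_pos hα hβ).ne'
      have h4 := (ProbabilityTheory.beta_pos hj hk).ne'
      rw [ProbabilityTheory.betaPDFReal, ProbabilityTheory.betaPDFReal, if_pos h, if_pos h,
        show α + j - 1 = α - 1 + j by ring, show β + k - 1 = β - 1 + k by ring,
        Real.rpow_add_natCast h.1.ne', Real.rpow_add_natCast h2.ne', smul_eq_mul]
      field_simp
    · simp [ProbabilityTheory.betaPDFReal, h]
  simp only [h1]
  rw [integral_const_mul, integral_betaPDFReal hj hk, mul_one]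
  have h5 := (Real.Gamma_pos_of_pos hα).ne'
  have h6 := (Real.Gamma_pos_of_pos hβ).ne'
  have h7 := (Real.Gamma_pos_of_pos (add_pos hα hβ)).ne'
  have h8 := (ascPochhammer_pos (j + k) (α + β) (add_pos hα hβ)).ne'
  rw [ProbabilityTheory.beta, ProbabilityTheory.beta, show α + j + (β + k) = α + β + (j + k : ℕ) by
    push_cast; ring, Gamma_add_natCast hα, Gamma_add_natCast hβ,
    Gamma_add_natCast (add_pos hα hβ)]
  field_simp

/-- The `n`-th difference of a polynomial of degree less than `n` vanishes. -/
lemma sum_neg_one_pow_mul_choose_mul_eval {n : ℕ} {p : ℝ[X]} (hp : p.natDegree < n) :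
    ∑ k ∈ Finset.range (n + 1), (-1 : ℝ) ^ k * (n.choose k : ℝ) * p.eval (k : ℝ) = 0 := by
  have h1 := congrFun (Polynomial.fwdDiff_iter_eq_zero_of_degree_lt hp) 0
  rw [fwdDiff_iter_eq_sum_shift] at h1
  have h2 : ∀ k ∈ Finset.range (n + 1), (-1 : ℝ) ^ k * (n.choose k : ℝ) * p.eval (k : ℝ) =
      (-1 : ℝ) ^ n *
        (((-1 : ℤ) ^ (n - k) * n.choose k) • Polynomial.eval (0 + k • (1 : ℝ)) p) := by
    intro k hk
    have hk' : k ≤ n := by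
      have := Finset.mem_range.1 hk
      omega
    have h3 : (-1 : ℝ) ^ n * (-1) ^ (n - k) = (-1) ^ k := by
      have h4 : (-1 : ℝ) ^ (n - k) * (-1) ^ (n - k) = 1 := by
        rw [← mul_pow]; norm_num
      calc (-1 : ℝ) ^ n * (-1) ^ (n - k) = (-1) ^ k * ((-1) ^ (n - k) * (-1) ^ (n - k)) := by
            conv_lhs => rw [← Nat.add_sub_cancel' hk', Nat.add_sub_cancel_left]
            rw [pow_add]; ring
        _ = _ := by rw [h4, mul_one]
    rw [zsmul_eq_mul, nsmul_eq_mul, mul_one, zero_add, ← h3]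
    push_cast
    ring
  rw [Finset.sum_congr rfl h2, ← Finset.mul_sum, h1]
  simp

/-- Orthogonality of the Jacobi polynomials to lower powers of `t = (1 + y) / 2`. Expanded in
powers of `1 - t`, the integral is an `n`-th difference of a polynomial of degree
`n - 1 - j`. -/
theorem integral_pow_mul_monicJacobi {a b : ℝ} (ha : -1 < a) (hb : -1 < b) {j n : ℕ}
    (hjn : j < n) :
    ∫ t, t ^ j * (monicJacobi a b n).eval (2 * t - 1)
      ∂(ProbabilityTheory.betaMeasure (b + 1) (a + 1)) = 0 := by
  have hα : 0 < b + 1 := by linarith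
  have hβ : 0 < a + 1 := by linarith
  obtain ⟨N, rfl⟩ : ∃ N, n = N + 1 := ⟨n - 1, by omega⟩
  set q := b + 1 + (a + 1) with hq
  have hq0 : 0 < q := by positivity
  have hprob := ProbabilityTheory.isProbabilityMeasureBeta hα hβ
  have hterm : ∀ k : ℕ, Integrable (fun t : ℝ => t ^ j * (1 - t) ^ k)
      (ProbabilityTheory.betaMeasure (b + 1) (a + 1)) := by
    intro k
    have := integrable_eval (integrable_pow_betaMeasure hα hβ)
      (Polynomial.X ^ j * (1 - Polynomial.X) ^ k)
    simpa using this
  set D : ℝ := 2 ^ (N + 1) * ((N + 1)! : ℝ) /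
    (ascPochhammer ℝ (N + 1)).eval (((N + 1 : ℕ) : ℝ) + a + b + 1) with hD
  set E : ℕ → ℝ := fun k => (((N + 1).choose k : ℝ) / ((N + 1)! : ℝ)
        * (ascPochhammer ℝ k).eval (((N + 1 : ℕ) : ℝ) + a + b + 1)
        * (ascPochhammer ℝ (N + 1 - k)).eval (a + (k : ℝ) + 1)) with hE
  have h1 : ∀ t : ℝ, t ^ j * (monicJacobi a b (N + 1)).eval (2 * t - 1) =
      ∑ k ∈ Finset.range (N + 1 + 1), (D * E k * (-1) ^ k) * (t ^ j * (1 - t) ^ k) := by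
    intro t
    rw [show 2 * t - 1 = 2 * (t - 1) + 1 by ring, eval_monicJacobi, Finset.mul_sum, Finset.mul_sum]
    refine Finset.sum_congr rfl fun k _ => ?_
    rw [show t - 1 = (-1) * (1 - t) by ring, mul_pow]
    ring
  simp only [h1]
  rw [integral_finsetSum _ fun k _ => (hterm k).const_mul _]
  simp only [integral_const_mul, integral_pow_mul_pow_betaMeasure hα hβ]
  set p : ℝ[X] := (ascPochhammer ℝ (N - j)).comp (Polynomial.X + Polynomial.C (q + j)) with hp
  have hpdeg : p.natDegree < N + 1 := by
    rw [hp, Polynomial.natDegree_comp, Polynomial.natDegree_X_add_C, ascPochhammer_natDegree]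
    omega
  have h2 : ∀ k ∈ Finset.range (N + 1 + 1), (D * E k * (-1) ^ k) *
      ((ascPochhammer ℝ j).eval (b + 1) * (ascPochhammer ℝ k).eval (a + 1)
        / (ascPochhammer ℝ (j + k)).eval q) =
      (D * (ascPochhammer ℝ j).eval (b + 1) * (ascPochhammer ℝ (N + 1)).eval (a + 1)
        / ((N + 1)! * (ascPochhammer ℝ N).eval q)) *
        ((-1 : ℝ) ^ k * ((N + 1).choose k : ℝ) * p.eval (k : ℝ)) := by
    intro k hk
    have hk' : k ≤ N + 1 := by
      have := Finset.mem_range.1 hk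
      omega
    have h3 : (ascPochhammer ℝ (N + 1)).eval (a + 1) =
        (ascPochhammer ℝ k).eval (a + 1) * (ascPochhammer ℝ (N + 1 - k)).eval (a + k + 1) := by
      conv_lhs => rw [← Nat.add_sub_cancel' hk', eval_ascPochhammer_add]
      rw [show a + 1 + (k : ℝ) = a + k + 1 by ring]
    have h4 : (ascPochhammer ℝ N).eval q * (ascPochhammer ℝ k).eval (q + N) =
        (ascPochhammer ℝ (j + k)).eval q * p.eval (k : ℝ) := by
      rw [← eval_ascPochhammer_add, show N + k = (j + k) + (N - j) by omega,
        eval_ascPochhammer_add _ (j + k), hp, Polynomial.eval_comp]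
      simp only [Polynomial.eval_add, Polynomial.eval_X, Polynomial.eval_C]
      rw [show q + ((j + k : ℕ) : ℝ) = k + (q + j) by push_cast; ring]
    have h5 := (ascPochhammer_pos (j + k) q hq0).ne'
    have h6 := (ascPochhammer_pos N q hq0).ne'
    simp only [hE, h3]
    rw [show ((N + 1 : ℕ) : ℝ) + a + b + 1 = q + N by rw [hq]; push_cast; ring]
    have h7 : ((N + 1)! : ℝ) ≠ 0 := by positivity
    generalize (ascPochhammer ℝ (N + 1 - k)).eval (a + (k : ℝ) + 1) = A1 at *
    generalize (ascPochhammer ℝ k).eval (a + 1) = A2 at *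
    generalize (ascPochhammer ℝ k).eval (q + (N : ℝ)) = A3 at *
    generalize (ascPochhammer ℝ (j + k)).eval q = A4 at *
    generalize (ascPochhammer ℝ N).eval q = A5 at *
    generalize p.eval (k : ℝ) = A6 at *
    generalize D = A7 at *
    field_simp
    linear_combination
      (A7 * ((N + 1).choose k : ℝ) * A1 * (ascPochhammer ℝ j).eval (b + 1) * A2) * h4
  rw [Finset.sum_congr rfl h2, ← Finset.mul_sum, sum_neg_one_pow_mul_choose_mul_eval hpdeg,
    mul_zero]

lemma natDegree_monicJacobi_le (a b : ℝ) (n : ℕ) : (monicJacobi a b n).natDegree ≤ n := by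
  refine (Polynomial.natDegree_C_mul_le _ _).trans ?_
  refine Polynomial.natDegree_sum_le_of_forall_le _ _ fun k hk => ?_
  refine (Polynomial.natDegree_C_mul_le _ _).trans ((Polynomial.natDegree_pow_le).trans ?_)
  have : (Polynomial.C (1 / 2 : ℝ) * (Polynomial.X - 1)).natDegree ≤ 1 :=
    (Polynomial.natDegree_C_mul_le _ _).trans (Polynomial.natDegree_X_sub_C_le (1 : ℝ))
  have := Finset.mem_range.1 hk
  nlinarith

lemma coeff_monicJacobi {a b : ℝ} (h : 0 < a + b + 1) (n : ℕ) :
    (monicJacobi a b n).coeff n = 1 := by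
  have hlin : (Polynomial.C (1 / 2 : ℝ) * (Polynomial.X - 1)).natDegree ≤ 1 :=
    (Polynomial.natDegree_C_mul_le _ _).trans (Polynomial.natDegree_X_sub_C_le (1 : ℝ))
  have hpos := (ascPochhammer_pos n ((n : ℝ) + a + b + 1)
    (by have : (0 : ℝ) ≤ n := Nat.cast_nonneg n
        linarith)).ne'
  rw [monicJacobi, jacobi, Polynomial.coeff_C_mul, Polynomial.finsetSum_coeff,
    Finset.sum_range_succ, Finset.sum_eq_zero, zero_add, Polynomial.coeff_C_mul]
  · have h2 := Polynomial.coeff_pow_of_natDegree_le (m := n) hlin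
    rw [mul_one] at h2
    rw [h2, Nat.sub_self, Nat.choose_self, Polynomial.coeff_C_mul, Polynomial.coeff_sub,
      Polynomial.coeff_X_one, Polynomial.coeff_one]
    have : (n ! : ℝ) ≠ 0 := by positivity
    simp
    field_simp
  · intro k hk
    rw [Polynomial.coeff_eq_zero_of_natDegree_lt]
    refine (Polynomial.natDegree_C_mul_le _ _).trans_lt ((Polynomial.natDegree_pow_le).trans_lt ?_)
    have := Finset.mem_range.1 hk
    nlinarith

/-! ### The shifted Beta distribution and its orthogonal polynomials -/

/-- The image of the Beta distribution with parameters `lam - eps / 2`, `lam + eps / 2` under the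
affine map sending `t` to the point `x` with `(√(2 lam - 1) x - eps) / (2 lam) = 2 t - 1`. -/
noncomputable def shiftedBeta (lam eps : ℝ) : Measure ℝ :=
  (ProbabilityTheory.betaMeasure (lam - eps / 2) (lam + eps / 2)).map
    (fun t => 4 * lam / √(2 * lam - 1) * t + (eps - 2 * lam) / √(2 * lam - 1))

/-- The monic Jacobi polynomials with parameters `lam - 1 ± eps / 2` in the affine variable
`(√(2 lam - 1) x - eps) / (2 lam)`, rescaled to be monic in `x`. -/
noncomputable def shiftedJacobi (lam eps : ℝ) (n : ℕ) : ℝ[X] :=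
  Polynomial.C ((2 * lam / √(2 * lam - 1)) ^ n) *
    (monicJacobi (lam - 1 + eps / 2) (lam - 1 - eps / 2) n).comp
      (Polynomial.C (√(2 * lam - 1) / (2 * lam)) * Polynomial.X
        + Polynomial.C (-eps / (2 * lam)))

section

variable {lam eps : ℝ}

lemma sqrt_pos_of_half_lt (hlam : 1 / 2 < lam) : 0 < √(2 * lam - 1) :=
  Real.sqrt_pos.2 (by linarith)

lemma eval_shiftedJacobi (n : ℕ) (x : ℝ) :
    (shiftedJacobi lam eps n).eval x = (2 * lam / √(2 * lam - 1)) ^ n *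
      (monicJacobi (lam - 1 + eps / 2) (lam - 1 - eps / 2) n).eval
        ((√(2 * lam - 1) * x - eps) / (2 * lam)) := by
  simp only [shiftedJacobi, Polynomial.eval_mul, Polynomial.eval_C, Polynomial.eval_comp,
    Polynomial.eval_add, Polynomial.eval_X]
  congr 2
  ring

lemma natDegree_monicJacobi {a b : ℝ} (h : 0 < a + b + 1) (n : ℕ) :
    (monicJacobi a b n).natDegree = n :=
  Polynomial.natDegree_eq_of_le_of_coeff_ne_zero (natDegree_monicJacobi_le a b n)
    (by rw [coeff_monicJacobi h]; exact one_ne_zero)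

lemma natDegree_shiftedJacobi (hlam : 1 / 2 < lam) (n : ℕ) :
    (shiftedJacobi lam eps n).natDegree = n := by
  have hr := sqrt_pos_of_half_lt hlam
  have hl : 0 < lam := by linarith
  rw [shiftedJacobi, Polynomial.natDegree_C_mul (by positivity), Polynomial.natDegree_comp,
    Polynomial.natDegree_linear (by positivity), natDegree_monicJacobi (by linarith), mul_one]

lemma monic_shiftedJacobi (hlam : 1 / 2 < lam) (n : ℕ) : (shiftedJacobi lam eps n).Monic := by
  have hr := sqrt_pos_of_half_lt hlam
  have hl : 0 < lam := by linarith
  have h1 := coeff_monicJacobi (a := lam - 1 + eps / 2) (b := lam - 1 - eps / 2) (by linarith) n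
  rw [Polynomial.Monic, shiftedJacobi, Polynomial.leadingCoeff_mul, Polynomial.leadingCoeff_C,
    Polynomial.leadingCoeff_comp (by rw [Polynomial.natDegree_linear (by positivity)]; norm_num),
    Polynomial.leadingCoeff_linear (by positivity), Polynomial.leadingCoeff,
    natDegree_monicJacobi (by linarith), h1, one_mul, ← mul_pow]
  rw [show 2 * lam / √(2 * lam - 1) * (√(2 * lam - 1) / (2 * lam)) = 1 by field_simp, one_pow]

lemma abs_eps (heps : eps = 1 ∨ eps = -1) : |eps| = 1 := by
  rcases heps with rfl | rfl <;> simp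

lemma sub_eps_half_pos (hlam : 1 / 2 < lam) (heps : eps = 1 ∨ eps = -1) : 0 < lam - eps / 2 := by
  rcases heps with rfl | rfl <;> linarith

lemma add_eps_half_pos (hlam : 1 / 2 < lam) (heps : eps = 1 ∨ eps = -1) : 0 < lam + eps / 2 := by
  rcases heps with rfl | rfl <;> linarith

lemma isProbabilityMeasure_shiftedBeta (hlam : 1 / 2 < lam) (heps : eps = 1 ∨ eps = -1) :
    IsProbabilityMeasure (shiftedBeta lam eps) := by
  have := ProbabilityTheory.isProbabilityMeasureBeta (sub_eps_half_pos hlam heps)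
    (add_eps_half_pos hlam heps)
  exact Measure.isProbabilityMeasure_map (by fun_prop)

lemma ae_shiftedBeta (hlam : 1 / 2 < lam) :
    ∀ᵐ x ∂(shiftedBeta lam eps), |(√(2 * lam - 1) * x - eps) / (2 * lam)| ≤ 1 := by
  have hr := sqrt_pos_of_half_lt hlam
  have hl : 0 < lam := by linarith
  rw [shiftedBeta, ae_map_iff (by fun_prop) (measurableSet_le (by fun_prop) (by fun_prop))]
  filter_upwards [ae_betaMeasure (lam - eps / 2) (lam + eps / 2)] with t ht
  rw [show (√(2 * lam - 1) * (4 * lam / √(2 * lam - 1) * t + (eps - 2 * lam) / √(2 * lam - 1))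
    - eps) / (2 * lam) = 2 * t - 1 by field_simp; ring, abs_le]
  constructor <;> linarith [ht.1, ht.2]

/-- A bound for `|x|` on the support of `shiftedBeta`. -/
lemma abs_le_of_shiftedBeta (hlam : 1 / 2 < lam) (heps : eps = 1 ∨ eps = -1) {x : ℝ}
    (hx : |(√(2 * lam - 1) * x - eps) / (2 * lam)| ≤ 1) :
    |x| ≤ (2 * lam + 1) / √(2 * lam - 1) := by
  have hr := sqrt_pos_of_half_lt hlam
  have hl : 0 < lam := by linarith
  rw [abs_div, abs_of_pos (show 0 < 2 * lam by linarith), div_le_one (by positivity)] at hx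
  rw [le_div_iff₀ hr, ← abs_of_pos hr, ← abs_mul]
  have h1 := abs_add_le (√(2 * lam - 1) * x - eps) eps
  rw [sub_add_cancel, abs_eps heps] at h1
  rw [mul_comm]
  linarith

lemma integrable_pow_shiftedBeta (hlam : 1 / 2 < lam) (heps : eps = 1 ∨ eps = -1) (n : ℕ) :
    Integrable (fun x : ℝ => x ^ n) (shiftedBeta lam eps) := by
  have := isProbabilityMeasure_shiftedBeta hlam heps
  refine Integrable.of_bound (by fun_prop) (((2 * lam + 1) / √(2 * lam - 1)) ^ n) ?_
  filter_upwards [ae_shiftedBeta hlam] with x hx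
  rw [norm_pow, Real.norm_eq_abs]
  exact pow_le_pow_left₀ (abs_nonneg _) (abs_le_of_shiftedBeta hlam heps hx) n

lemma momentFunctional_shiftedBeta (q : ℝ[X]) :
    momentFunctional (shiftedBeta lam eps) q =
      momentFunctional (ProbabilityTheory.betaMeasure (lam - eps / 2) (lam + eps / 2))
        (q.comp (Polynomial.C (4 * lam / √(2 * lam - 1)) * Polynomial.X
          + Polynomial.C ((eps - 2 * lam) / √(2 * lam - 1)))) := by
  rw [momentFunctional, momentFunctional, shiftedBeta, integral_map (by fun_prop)
    (by exact q.continuous.aestronglyMeasurable)]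
  simp [Polynomial.eval_comp]

theorem isMonicOPS_shiftedJacobi (hlam : 1 / 2 < lam) (heps : eps = 1 ∨ eps = -1) :
    IsMonicOPS (shiftedBeta lam eps) (shiftedJacobi lam eps) := by
  have hr := sqrt_pos_of_half_lt hlam
  have hl : 0 < lam := by linarith
  have hα := sub_eps_half_pos hlam heps
  have hβ := add_eps_half_pos hlam heps
  set L : ℝ[X] := Polynomial.C (4 * lam / √(2 * lam - 1)) * Polynomial.X
          + Polynomial.C ((eps - 2 * lam) / √(2 * lam - 1)) with hL
  have hLdeg : L.natDegree = 1 := Polynomial.natDegree_linear (by positivity)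
  have hlt : ∀ m n, m < n →
      momentFunctional (shiftedBeta lam eps) (shiftedJacobi lam eps n * shiftedJacobi lam eps m)
        = 0 := by
    intro m n hmn
    rw [momentFunctional_shiftedBeta, Polynomial.mul_comp, ← hL]
    refine momentFunctional_mul_eq_zero (P := fun k => Polynomial.X ^ k)
      (integrable_pow_betaMeasure hα hβ) (fun k => Polynomial.monic_X_pow k)
      (fun k => Polynomial.natDegree_X_pow k) _ n (fun k hk => ?_) _ ?_
    · have h1 := integral_pow_mul_monicJacobi (a := lam - 1 + eps / 2) (b := lam - 1 - eps / 2)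
        (by linarith) (by linarith) hk
      rw [show lam - 1 - eps / 2 + 1 = lam - eps / 2 by ring,
        show lam - 1 + eps / 2 + 1 = lam + eps / 2 by ring] at h1
      have h2 : ∀ t : ℝ, ((shiftedJacobi lam eps n).comp L * Polynomial.X ^ k).eval t =
          (2 * lam / √(2 * lam - 1)) ^ n * (t ^ k *
            (monicJacobi (lam - 1 + eps / 2) (lam - 1 - eps / 2) n).eval (2 * t - 1)) := by
        intro t
        rw [Polynomial.eval_mul, Polynomial.eval_comp, eval_shiftedJacobi, hL]
        simp only [Polynomial.eval_add, Polynomial.eval_mul, Polynomial.eval_C,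
          Polynomial.eval_X, Polynomial.eval_pow]
        rw [show (√(2 * lam - 1) * (4 * lam / √(2 * lam - 1) * t
          + (eps - 2 * lam) / √(2 * lam - 1)) - eps) / (2 * lam) = 2 * t - 1 by field_simp; ring]
        ring
      simp only [momentFunctional, h2]
      rw [integral_const_mul, h1, mul_zero]
    · refine Polynomial.degree_le_natDegree.trans_lt ?_
      rw [Polynomial.natDegree_comp, hLdeg, natDegree_shiftedJacobi hlam, mul_one]
      exact_mod_cast hmn
  refine ⟨monic_shiftedJacobi hlam, natDegree_shiftedJacobi hlam, fun m n hmn => ?_⟩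
  rcases lt_or_gt_of_ne hmn with h | h
  · have := hlt m n h
    rw [mul_comm] at this
    simpa [momentFunctional] using this
  · simpa [momentFunctional] using hlt n m h

/-- The shifted Beta distribution is positive definite on polynomials. -/
lemma momentFunctional_shiftedBeta_mul_self_pos (hlam : 1 / 2 < lam)
    (heps : eps = 1 ∨ eps = -1) (q : ℝ[X]) (hq : q ≠ 0) :
    0 < momentFunctional (shiftedBeta lam eps) (q * q) := by
  have hr := sqrt_pos_of_half_lt hlam
  have hl : 0 < lam := by linarith
  have hα := sub_eps_half_pos hlam heps
  have hβ := add_eps_half_pos hlam heps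
  have hprob := ProbabilityTheory.isProbabilityMeasureBeta hα hβ
  rw [momentFunctional_shiftedBeta, Polynomial.mul_comp]
  set p := q.comp (Polynomial.C (4 * lam / √(2 * lam - 1)) * Polynomial.X
          + Polynomial.C ((eps - 2 * lam) / √(2 * lam - 1))) with hp
  have hp0 : p ≠ 0 := by
    intro h0
    rw [hp, Polynomial.comp_eq_zero_iff] at h0
    rcases h0 with h0 | h0
    · exact hq h0
    · have h1 := congrArg Polynomial.natDegree h0.2
      rw [Polynomial.natDegree_linear (by positivity), Polynomial.natDegree_C] at h1
      exact one_ne_zero h1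
  have hnonneg : 0 ≤ᵐ[ProbabilityTheory.betaMeasure (lam - eps / 2) (lam + eps / 2)]
      fun t => (p * p).eval t := ae_of_all _ fun t => by
    simpa using mul_self_nonneg (p.eval t)
  refine lt_of_le_of_ne (integral_nonneg_of_ae hnonneg) fun h0 => ?_
  have h1 := (integral_eq_zero_iff_of_nonneg_ae hnonneg
    (integrable_eval (integrable_pow_betaMeasure hα hβ) _)).1 h0.symm
  -- the Beta distribution has a density, so it does not charge the finitely many roots of `p`
  have h2 : (ProbabilityTheory.betaMeasure (lam - eps / 2) (lam + eps / 2))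
      (p.rootSet ℝ) = 0 :=
    withDensity_absolutelyContinuous _ _ ((p.rootSet_finite ℝ).measure_zero _)
  have h3 : ∀ᵐ t ∂(ProbabilityTheory.betaMeasure (lam - eps / 2) (lam + eps / 2)),
      t ∉ p.rootSet ℝ := by
    rw [ae_iff]; simpa using h2
  obtain ⟨t, ht, ht'⟩ := (h1.and h3).exists
  refine ht' ?_
  rw [Polynomial.mem_rootSet]
  refine ⟨hp0, ?_⟩
  simpa using ht

/-- The shifted Beta distribution has the density `(1 - y) ^ a (1 + y) ^ b` up to a constant. -/
theorem shiftedBeta_eq_betaMeasureOn (hlam : 1 / 2 < lam) (heps : eps = 1 ∨ eps = -1) :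
    ∃ c : ℝ, 0 < c ∧ shiftedBeta lam eps =
      betaMeasureOn c (lam - 1 + eps / 2) (lam - 1 - eps / 2)
        ((eps - 2 * lam) / √(2 * lam - 1)) ((eps + 2 * lam) / √(2 * lam - 1))
        (fun x => (√(2 * lam - 1) * x - eps) / (2 * lam)) := by
  have hr := sqrt_pos_of_half_lt hlam
  have hl : 0 < lam := by linarith
  have hα := sub_eps_half_pos hlam heps
  have hβ := add_eps_half_pos hlam heps
  set r := √(2 * lam - 1) with hrdef
  set m := 4 * lam / r with hm
  set d := (eps - 2 * lam) / r with hd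
  have hm0 : 0 < m := by positivity
  set B := ProbabilityTheory.beta (lam - eps / 2) (lam + eps / 2) with hB
  have hB0 : 0 < B := ProbabilityTheory.beta_pos hα hβ
  refine ⟨1 / (m * B * (2 ^ (lam - 1 + eps / 2) * 2 ^ (lam - 1 - eps / 2))), by positivity, ?_⟩
  set c := 1 / (m * B * ((2 : ℝ) ^ (lam - 1 + eps / 2) * 2 ^ (lam - 1 - eps / 2))) with hc
  have hvol : Measure.map (fun t : ℝ => m * t + d) volume = ENNReal.ofReal m⁻¹ • volume := by
    have h1 : (fun t : ℝ => m * t + d) = (fun t => t + d) ∘ (fun t => m * t) := rfl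
    rw [h1, ← Measure.map_map (by fun_prop) (by fun_prop), Real.map_volume_mul_left hm0.ne',
      abs_of_pos (inv_pos.2 hm0), Measure.map_smul, map_add_right_eq_self]
  have hmeas : Measurable fun x : ℝ => ENNReal.ofReal (c * ((1 - (r * x - eps) / (2 * lam)) ^
      (lam - 1 + eps / 2) * (1 + (r * x - eps) / (2 * lam)) ^ (lam - 1 - eps / 2))) := by
    fun_prop
  have hmeasB : Measurable (ProbabilityTheory.betaPDF (lam - eps / 2) (lam + eps / 2)) := by
    unfold ProbabilityTheory.betaPDF; fun_prop
  refine Measure.ext fun A hA => ?_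
  have hφ : Measurable fun t : ℝ => m * t + d := by fun_prop
  have hendpoint : (d + m) = (eps + 2 * lam) / r := by
    rw [hd, hm]; field_simp; ring
  rw [shiftedBeta, Measure.map_apply hφ hA, ProbabilityTheory.betaMeasure,
    withDensity_apply _ (hφ hA), betaMeasureOn, withDensity_apply _ hA,
    ← lintegral_indicator (hφ hA), ← lintegral_indicator hA,
    ← lintegral_indicator measurableSet_Icc]
  have hscale : ∀ G : ℝ → ENNReal, Measurable G →
      ∫⁻ x, G x = ENNReal.ofReal m * ∫⁻ t, G (m * t + d) := by
    intro G hG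
    rw [← lintegral_map hG hφ, hvol, lintegral_smul_measure, smul_eq_mul, ← mul_assoc,
      ← ENNReal.ofReal_mul hm0.le, mul_inv_cancel₀ hm0.ne', ENNReal.ofReal_one, one_mul]
  rw [hscale _ ((hmeas.indicator hA).indicator measurableSet_Icc),
    ← lintegral_const_mul' _ _ ENNReal.ofReal_ne_top]
  -- the endpoints carry no mass; the Beta density is cut off on the open interval, the other
  -- density on the closed one
  have hne : ∀ s : ℝ, ∀ᵐ t : ℝ, t ≠ s := fun s => by
    rw [ae_iff]; simp
  refine lintegral_congr_ae ?_
  filter_upwards [hne 0, hne 1] with t ht0 ht1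
  have hy : (r * (m * t + d) - eps) / (2 * lam) = 2 * t - 1 := by
    rw [hm, hd]; field_simp; ring
  by_cases ht : 0 < t ∧ t < 1
  · have hmem : m * t + d ∈ Set.Icc d ((eps + 2 * lam) / r) := by
      rw [← hendpoint]
      constructor <;> nlinarith [ht.1, ht.2]
    rw [Set.indicator_of_mem hmem]
    by_cases hA' : m * t + d ∈ A
    · rw [Set.indicator_of_mem hA', Set.indicator_of_mem (show t ∈ (fun t => m * t + d) ⁻¹' A
        from hA'), ProbabilityTheory.betaPDF_of_pos_lt_one ht.1 ht.2, hy,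
        ← ENNReal.ofReal_mul hm0.le]
      congr 1
      rw [show 1 - (2 * t - 1) = 2 * (1 - t) by ring, show 1 + (2 * t - 1) = 2 * t by ring,
        Real.mul_rpow zero_le_two (by linarith [ht.2]), Real.mul_rpow zero_le_two ht.1.le,
        show lam - eps / 2 - 1 = lam - 1 - eps / 2 by ring,
        show lam + eps / 2 - 1 = lam - 1 + eps / 2 by ring, hc]
      have h2 := (Real.rpow_pos_of_pos (two_pos (α := ℝ)) (lam - 1 + eps / 2)).ne'
      have h3 := (Real.rpow_pos_of_pos (two_pos (α := ℝ)) (lam - 1 - eps / 2)).ne'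
      generalize (2 : ℝ) ^ (lam - 1 + eps / 2) = u at *
      generalize (2 : ℝ) ^ (lam - 1 - eps / 2) = v at *
      rw [← hB]
      field_simp
    · rw [Set.indicator_of_notMem hA', Set.indicator_of_notMem
        (show t ∉ (fun t => m * t + d) ⁻¹' A from hA'), mul_zero]
  · have hmem : m * t + d ∉ Set.Icc d ((eps + 2 * lam) / r) := by
      rw [← hendpoint]
      rintro ⟨h1, h2⟩
      have h3 : 0 ≤ t := by by_contra h; push Not at h; nlinarith
      have h4 : t ≤ 1 := by by_contra h; push Not at h; nlinarith
      exact ht ⟨lt_of_le_of_ne h3 (Ne.symm ht0), lt_of_le_of_ne h4 ht1⟩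
    rw [Set.indicator_of_notMem hmem, mul_zero]
    simp [Set.indicator, ProbabilityTheory.betaPDF_eq, ht]

end

/-! ### Integrals of powers of `w - x` -/

lemma sub_ofReal_mem_slitPlane {w : ℂ} (hw : w.im ≠ 0) (x : ℝ) :
    w - (x : ℂ) ∈ Complex.slitPlane := by
  rw [Complex.mem_slitPlane_iff]
  right
  simpa using hw

lemma sub_ofReal_ne_zero {w : ℂ} (hw : w.im ≠ 0) (x : ℝ) : w - (x : ℂ) ≠ 0 :=
  Complex.slitPlane_ne_zero (sub_ofReal_mem_slitPlane hw x)

lemma abs_im_le_norm_sub_ofReal (w : ℂ) (x : ℝ) : |w.im| ≤ ‖w - (x : ℂ)‖ := by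
  simpa using Complex.abs_im_le_norm (w - (x : ℂ))

lemma norm_sub_ofReal_le (w : ℂ) (x : ℝ) : ‖w - (x : ℂ)‖ ≤ ‖w‖ + |x| := by
  simpa using norm_sub_le w (x : ℂ)

/-- For `p ≤ n`, the power `(w - x) ^ p` grows at most like `|x| ^ n`, locally uniformly in
`w` off the real axis. -/
lemma norm_sub_cpow_le {p δ R : ℝ} {n : ℕ} (hp : p ≤ n) (hδ : 0 < δ) {w : ℂ}
    (hw : δ ≤ |w.im|) (hR : ‖w‖ ≤ R) (x : ℝ) :
    ‖(w - (x : ℂ)) ^ (p : ℂ)‖ ≤ δ ^ (p - n) * (R + |x|) ^ n := by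
  have h1 : δ ≤ ‖w - (x : ℂ)‖ := hw.trans (abs_im_le_norm_sub_ofReal w x)
  have h2 : 0 < ‖w - (x : ℂ)‖ := hδ.trans_le h1
  have h3 : ‖w - (x : ℂ)‖ ≤ R + |x| := (norm_sub_ofReal_le w x).trans (by linarith)
  rw [Complex.norm_cpow_real]
  calc ‖w - (x : ℂ)‖ ^ p = ‖w - (x : ℂ)‖ ^ (p - n) * ‖w - (x : ℂ)‖ ^ n := by
        rw [← Real.rpow_add_natCast h2.ne']; congr 1; ring
    _ ≤ δ ^ (p - n) * (R + |x|) ^ n := by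
        have h4 : p - n ≤ 0 := by linarith
        exact mul_le_mul (Real.rpow_le_rpow_of_nonpos hδ h1 h4)
          (pow_le_pow_left₀ (norm_nonneg _) h3 n) (by positivity) (by positivity)

lemma measurable_sub_cpow (w : ℂ) (p : ℂ) : Measurable fun x : ℝ => (w - (x : ℂ)) ^ p := by
  fun_prop

lemma integrable_add_abs_pow {μ : Measure ℝ} (hm : ∀ n : ℕ, Integrable (fun x : ℝ => x ^ n) μ)
    (R : ℝ) (n : ℕ) : Integrable (fun x : ℝ => (R + |x|) ^ n) μ := by
  simp only [add_pow]
  refine integrable_finsetSum _ fun k _ => ?_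
  have h := ((hm (n - k)).abs.const_mul (R ^ k)).mul_const (n.choose k : ℝ)
  simpa [abs_pow] using h

lemma integrable_pow_mul_sub_cpow {μ : Measure ℝ}
    (hm : ∀ n : ℕ, Integrable (fun x : ℝ => x ^ n) μ) {w : ℂ} (hw : w.im ≠ 0) (k : ℕ) (p : ℝ) :
    Integrable (fun x : ℝ => (x : ℂ) ^ k * (w - (x : ℂ)) ^ (p : ℂ)) μ := by
  obtain ⟨n, hn⟩ := exists_nat_ge p
  have hg := (integrable_add_abs_pow hm ‖w‖ (k + n)).const_mul (|w.im| ^ (p - n))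
  refine hg.mono' (by
    exact ((by fun_prop : Measurable fun x : ℝ => (x : ℂ) ^ k).mul
      (measurable_sub_cpow w p)).aestronglyMeasurable) (ae_of_all _ fun x => ?_)
  have h1 := norm_sub_cpow_le hn (abs_pos.2 hw) le_rfl le_rfl x (w := w)
  have h2 : |x| ^ k ≤ (‖w‖ + |x|) ^ k :=
    pow_le_pow_left₀ (abs_nonneg x) (by linarith [norm_nonneg w]) k
  rw [norm_mul, norm_pow, Complex.norm_real, Real.norm_eq_abs]
  calc |x| ^ k * ‖(w - (x : ℂ)) ^ (p : ℂ)‖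
      ≤ (‖w‖ + |x|) ^ k * (|w.im| ^ (p - n) * (‖w‖ + |x|) ^ n) := by gcongr
    _ = |w.im| ^ (p - n) * (‖w‖ + |x|) ^ (k + n) := by rw [pow_add]; ring

/-- Differentiation under the integral sign. -/
theorem hasDerivAt_integral_sub_cpow {μ : Measure ℝ}
    (hm : ∀ n : ℕ, Integrable (fun x : ℝ => x ^ n) μ) {w : ℂ} (hw : w.im ≠ 0) (p : ℝ) :
    HasDerivAt (fun w : ℂ => ∫ x : ℝ, (w - (x : ℂ)) ^ (p : ℂ) ∂μ)
      (∫ x : ℝ, (p : ℂ) * (w - (x : ℂ)) ^ ((p - 1 : ℝ) : ℂ) ∂μ) w := by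
  obtain ⟨n, hn⟩ := exists_nat_ge (p - 1)
  set δ := |w.im| / 2 with hδ
  have hδ0 : 0 < δ := half_pos (abs_pos.2 hw)
  have him : ∀ v ∈ Metric.ball w δ, δ ≤ |v.im| := by
    intro v hv
    have h1 : |(v - w).im| < δ := (Complex.abs_im_le_norm _).trans_lt (by
      rwa [Metric.mem_ball, dist_eq_norm] at hv)
    rw [Complex.sub_im] at h1
    have h2 := abs_sub_abs_le_abs_sub w.im v.im
    rw [abs_sub_comm] at h2
    linarith
  have hnorm : ∀ v ∈ Metric.ball w δ, ‖v‖ ≤ ‖w‖ + δ := by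
    intro v hv
    have h1 : ‖v - w‖ < δ := by rwa [Metric.mem_ball, dist_eq_norm] at hv
    have h2 := norm_sub_norm_le v w
    linarith
  refine (hasDerivAt_integral_of_dominated_loc_of_deriv_le (μ := μ) (s := Metric.ball w δ)
    (F := fun (w : ℂ) (x : ℝ) => (w - (x : ℂ)) ^ (p : ℂ))
    (F' := fun (w : ℂ) (x : ℝ) => (p : ℂ) * (w - (x : ℂ)) ^ ((p - 1 : ℝ) : ℂ))
    (bound := fun x => |p| * (δ ^ (p - 1 - n) * (‖w‖ + δ + |x|) ^ n))
    (Metric.ball_mem_nhds w hδ0) ?_ ?_ ?_ ?_ ?_ ?_).2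
  · exact Eventually.of_forall fun v => (measurable_sub_cpow v p).aestronglyMeasurable
  · simpa using integrable_pow_mul_sub_cpow hm hw 0 p
  · exact ((measurable_sub_cpow w _).const_mul _).aestronglyMeasurable
  · refine ae_of_all _ fun x v hv => ?_
    rw [norm_mul, Complex.norm_real, Real.norm_eq_abs]
    exact mul_le_mul_of_nonneg_left (norm_sub_cpow_le hn hδ0 (him v hv) (hnorm v hv) x)
      (abs_nonneg p)
  · exact ((integrable_add_abs_pow hm _ n).const_mul _).const_mul _
  · refine ae_of_all _ fun x v hv => ?_
    have hv0 : v.im ≠ 0 := by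
      intro h
      have := him v hv
      rw [h, abs_zero] at this
      linarith
    have h1 := ((hasDerivAt_id v).sub_const (x : ℂ)).cpow_const (c := (p : ℂ))
      (sub_ofReal_mem_slitPlane hv0 x)
    simpa using h1

lemma sub_mul_sub_cpow {w : ℂ} (hw : w.im ≠ 0) (x p : ℝ) :
    (w - (x : ℂ)) ^ ((p + 1 : ℝ) : ℂ) =
      w * ((x : ℂ) ^ 0 * (w - (x : ℂ)) ^ (p : ℂ)) - (x : ℂ) ^ 1 * (w - (x : ℂ)) ^ (p : ℂ) := by
  push_cast
  rw [Complex.cpow_add _ _ (sub_ofReal_ne_zero hw x), Complex.cpow_one]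
  ring

lemma sub_sq_mul_sub_cpow {w : ℂ} (hw : w.im ≠ 0) (x p : ℝ) :
    (w - (x : ℂ)) ^ ((p + 2 : ℝ) : ℂ) =
      w ^ 2 * ((x : ℂ) ^ 0 * (w - (x : ℂ)) ^ (p : ℂ))
        - 2 * w * ((x : ℂ) ^ 1 * (w - (x : ℂ)) ^ (p : ℂ))
        + (x : ℂ) ^ 2 * (w - (x : ℂ)) ^ (p : ℂ) := by
  push_cast
  rw [Complex.cpow_add _ _ (sub_ofReal_ne_zero hw x), Complex.cpow_ofNat]
  ring

/-! ### Low moments against orthogonal polynomials -/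

section moments

variable {μ : Measure ℝ} {P : ℕ → ℝ[X]} {α ω : ℕ → ℝ}

lemma IsStandard.momentFunctional_X (hμ : IsStandard μ) :
    momentFunctional μ Polynomial.X = 0 := by simpa [momentFunctional] using hμ.mean

lemma IsStandard.momentFunctional_X_sq (hμ : IsStandard μ) :
    momentFunctional μ (Polynomial.X ^ 2) = 1 := by simpa [momentFunctional] using hμ.variance

lemma IsStandard.one_eq_X (hμ : IsStandard μ) (hP : IsMonicOPS μ P) (hJ : IsJacobiSzego P α ω) :
    P 1 = Polynomial.X := by
  have := hμ.prob
  have h1 := hJ.rec_zero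
  rw [hP.zero_eq_one, mul_one, mul_one] at h1
  have h2 := hP.momentFunctional_eq_zero one_ne_zero
  have h3 : P 1 = Polynomial.X - Polynomial.C (α 0) * 1 := by rw [h1]; ring
  rw [hP.zero_eq_one, mul_one, h3, momentFunctional_sub hμ.moments, momentFunctional_C_mul,
    momentFunctional_one, hμ.momentFunctional_X] at h2
  rw [h3, show α 0 = 0 by linarith]
  simp

/-- The integrals `∫ x ^ 2 P_1 dμ` and `∫ x ^ 2 P_2 dμ`, and the vanishing of `∫ x ^ i P_n dμ` for
`i < n`: the only terms that matter in the series for `∫ x ^ i (f - x) ^ (-lam) dμ`, `i ≤ 2`. -/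
lemma IsStandard.momentFunctional_mul (hμ : IsStandard μ) (hP : IsMonicOPS μ P)
    (hJ : IsJacobiSzego P α ω) :
    momentFunctional μ (Polynomial.X ^ 2 * P 1) = α 1 ∧
      momentFunctional μ (Polynomial.X ^ 2 * P 2) = ω 2 ∧
      ∀ i n, i < n → momentFunctional μ (Polynomial.X ^ i * P n) = 0 := by
  have := hμ.prob
  have hm := hμ.moments
  have h1 := hμ.one_eq_X hP hJ
  have hlt : ∀ i n, i < n → momentFunctional μ (Polynomial.X ^ i * P n) = 0 := by
    intro i n hin
    rw [mul_comm]
    exact hP.orthogonal_of_degree_lt hm n (by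
      rw [Polynomial.degree_X_pow]; exact_mod_cast hin)
  refine ⟨?_, ?_, hlt⟩
  · have h2 : Polynomial.X ^ 2 * P 1 = Polynomial.X ^ 1 * P 2 +
        Polynomial.C (α 1) * Polynomial.X ^ 2 + Polynomial.C (ω 1) * Polynomial.X := by
      have h3 := hJ.rec_succ 0
      simp only [zero_add] at h3
      rw [hP.zero_eq_one, h1] at h3
      rw [h1]
      linear_combination Polynomial.X * h3
    rw [h2, momentFunctional_add hm, momentFunctional_add hm, momentFunctional_C_mul,
      momentFunctional_C_mul, hlt 1 2 (by norm_num), hμ.momentFunctional_X,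
      hμ.momentFunctional_X_sq]
    ring
  · have h2 : Polynomial.X ^ 2 * P 2 = Polynomial.X ^ 1 * P 3 +
        Polynomial.C (α 2) * (Polynomial.X ^ 1 * P 2) + Polynomial.C (ω 2) * Polynomial.X ^ 2 := by
      have h3 := hJ.rec_succ 1
      simp only [Nat.reduceAdd] at h3
      rw [h1] at h3
      linear_combination Polynomial.X * h3
    rw [h2, momentFunctional_add hm, momentFunctional_add hm, momentFunctional_C_mul,
      momentFunctional_C_mul, hlt 1 2 (by norm_num), hlt 1 3 (by norm_num),
      hμ.momentFunctional_X_sq]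
    ring

end moments

/-! ### The differential equation for `f` -/

section GF

variable {lam : ℝ} {μ : Measure ℝ} {P : ℕ → ℝ[X]} {α ω : ℕ → ℝ} {S : Set ℂ} {f u : ℂ → ℂ}

/-- The hypothesis on exchanging sum and integral evaluates the integrals of
`x ^ i (f(z) - x) ^ (-lam)` in terms of the moments of `P`. -/
lemma HasUltrasphericalGF.integral_div (hG : HasUltrasphericalGF lam μ P S f u)
    {z : ℂ} (hz : z ∈ S) {i : ℕ} (hi : i ≤ 2) :
    (u z)⁻¹ * ∫ x : ℝ, (x : ℂ) ^ i * (f z - (x : ℂ)) ^ ((-lam : ℝ) : ℂ) ∂μ =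
      ∑' n : ℕ, ((coeff lam n * momentFunctional μ (Polynomial.X ^ i * P n) : ℝ) : ℂ) * z ^ n := by
  have h1 := hG.exchange z hz i hi
  simp only [momentFunctional, Polynomial.eval_mul, Polynomial.eval_pow, Polynomial.eval_X]
  rw [← h1, ← integral_const_mul]
  refine integral_congr_ae ?_
  filter_upwards [Measure.support_mem_ae (μ := μ)] with x hx
  have h2 := ((hG.hasSum z hz x hx).mul_left ((x : ℂ) ^ i)).tsum_eq
  rw [show (∑' n : ℕ, ((coeff lam n * (x ^ i * (P n).eval x) : ℝ) : ℂ) * z ^ n) =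
    ∑' n : ℕ, (x : ℂ) ^ i * (((coeff lam n * (P n).eval x : ℝ) : ℂ) * z ^ n) from
      tsum_congr fun n => by push_cast; ring, h2]
  push_cast
  rw [Complex.cpow_neg, one_div, mul_inv]
  ring

end GF

section ODE

variable {lam : ℝ} {μ : Measure ℝ} {P : ℕ → ℝ[X]} {α ω : ℕ → ℝ} {S : Set ℂ} {f u : ℂ → ℂ}

/-- By orthogonality the series for `∫ x ^ i (f(z) - x) ^ (-lam) dμ` stops at `n = i`. -/
lemma HasUltrasphericalGF.integral_eq (hG : HasUltrasphericalGF lam μ P S f u)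
    (hμ : IsStandard μ) (hP : IsMonicOPS μ P) (hJ : IsJacobiSzego P α ω) {z : ℂ} (hz : z ∈ S) :
    u z ≠ 0 ∧
    ∫ x : ℝ, (x : ℂ) ^ 0 * (f z - (x : ℂ)) ^ ((-lam : ℝ) : ℂ) ∂μ = u z ∧
    ∫ x : ℝ, (x : ℂ) ^ 1 * (f z - (x : ℂ)) ^ ((-lam : ℝ) : ℂ) ∂μ = lam * z * u z ∧
    ∫ x : ℝ, (x : ℂ) ^ 2 * (f z - (x : ℂ)) ^ ((-lam : ℝ) : ℂ) ∂μ =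
      u z * (1 + lam * α 1 * z + lam * (lam + 1) / 2 * ω 2 * z ^ 2) := by
  have := hμ.prob
  obtain ⟨m21, m22, hlt⟩ := hμ.momentFunctional_mul hP hJ
  have hX := hμ.momentFunctional_X
  have hX2 := hμ.momentFunctional_X_sq
  have hfin : ∀ i ≤ 2, (u z)⁻¹ * ∫ x : ℝ, (x : ℂ) ^ i * (f z - (x : ℂ)) ^ ((-lam : ℝ) : ℂ) ∂μ =
      ∑ n ∈ Finset.range (i + 1),
        ((coeff lam n * momentFunctional μ (Polynomial.X ^ i * P n) : ℝ) : ℂ) * z ^ n := by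
    intro i hi
    rw [hG.integral_div hz hi]
    refine tsum_eq_sum fun n hn => ?_
    rw [hlt i n (by simpa using hn)]
    simp
  have h0 := hfin 0 (by norm_num)
  have h1 := hfin 1 (by norm_num)
  have h2 := hfin 2 (by norm_num)
  simp only [Finset.sum_range_succ, Finset.sum_range_zero, zero_add, coeff_zero, coeff_one,
    coeff_two, hP.zero_eq_one, mul_one, m21, m22, hX2] at h0 h1 h2
  rw [hμ.one_eq_X hP hJ, show (Polynomial.X ^ 1 * Polynomial.X : ℝ[X]) = Polynomial.X ^ 2 by ring,
    pow_one Polynomial.X, hX, hX2] at h1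
  rw [pow_zero, momentFunctional_one] at h0
  have hu : u z ≠ 0 := by
    intro h
    rw [h] at h0
    simp at h0
  refine ⟨hu, ?_, ?_, ?_⟩
  · rw [inv_mul_eq_iff_eq_mul₀ hu] at h0
    rw [h0]; simp
  · rw [inv_mul_eq_iff_eq_mul₀ hu] at h1
    rw [h1]; push_cast; ring
  · rw [inv_mul_eq_iff_eq_mul₀ hu] at h2
    rw [h2]; push_cast; ring

/-- With `H = ∫ (f - x) ^ (1 - lam) dμ = u (f - lam z)`, the relation `H' = (1 - lam) f' u`
becomes a differential equation for `u`. -/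
lemma HasUltrasphericalGF.deriv_u (hG : HasUltrasphericalGF lam μ P S f u)
    (hμ : IsStandard μ) (hP : IsMonicOPS μ P) (hJ : IsJacobiSzego P α ω) {z : ℂ} (hz : z ∈ S) :
    deriv u z * (f z - lam * z) = lam * u z * (1 - deriv f z) := by
  have hm := hμ.moments
  have hf := (hG.analytic_f z hz).differentiableAt.hasDerivAt
  have hu := (hG.analytic_u z hz).differentiableAt.hasDerivAt
  have hint : ∀ v ∈ S, ∫ x : ℝ, (f v - (x : ℂ)) ^ ((1 - lam : ℝ) : ℂ) ∂μ =
      u v * (f v - lam * v) := by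
    intro v hv
    obtain ⟨-, j0, j1, -⟩ := hG.integral_eq hμ hP hJ hv
    have him := hG.im_f v hv
    simp only [show 1 - lam = -lam + 1 by ring, sub_mul_sub_cpow him _ (-lam)]
    rw [integral_sub ((integrable_pow_mul_sub_cpow hm him 0 _).const_mul _)
      (integrable_pow_mul_sub_cpow hm him 1 _), integral_const_mul, j0, j1]
    ring
  have h1 := (hasDerivAt_integral_sub_cpow hm (hG.im_f z hz) (1 - lam)).comp z hf
  have h2 := hu.mul (hf.sub ((hasDerivAt_id z).const_mul (lam : ℂ)))
  have h3 : (fun v => u v * (f v - lam * v)) =ᶠ[𝓝 z]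
      ((fun w : ℂ => ∫ x : ℝ, (w - (x : ℂ)) ^ ((1 - lam : ℝ) : ℂ) ∂μ) ∘ f) := by
    filter_upwards [hG.region.isOpen.mem_nhds hz] with v hv
    exact (hint v hv).symm
  have h4 := h2.unique (h1.congr_of_eventuallyEq h3)
  rw [integral_const_mul, show 1 - lam - 1 = -lam by ring] at h4
  obtain ⟨-, j0, -, -⟩ := hG.integral_eq hμ hP hJ hz
  simp only [pow_zero, one_mul] at j0
  rw [j0] at h4
  push_cast at h4
  simp only [id_eq, Pi.sub_apply] at h4
  linear_combination h4

/-- With `K = ∫ (f - x) ^ (2 - lam) dμ`, the relation `K' = (2 - lam) f' H` and the equation for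
`u` give a Riccati-type equation for `f` alone. -/
lemma HasUltrasphericalGF.riccati (hG : HasUltrasphericalGF lam μ P S f u) (hlam : lam ≠ 0)
    (hμ : IsStandard μ) (hP : IsMonicOPS μ P) (hJ : IsJacobiSzego P α ω) {z : ℂ} (hz : z ∈ S) :
    (1 - deriv f z) * (1 + lam * α 1 * z + (lam * (lam + 1) / 2 * ω 2 - lam ^ 2) * z ^ 2) =
      f z ^ 2 - lam ^ 2 * z ^ 2 - (f z - lam * z) * (α 1 + (lam + 1) * ω 2 * z) := by
  have hm := hμ.moments
  have hf := (hG.analytic_f z hz).differentiableAt.hasDerivAt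
  have hu := (hG.analytic_u z hz).differentiableAt.hasDerivAt
  have hint : ∀ v ∈ S, ∫ x : ℝ, (f v - (x : ℂ)) ^ ((2 - lam : ℝ) : ℂ) ∂μ =
      u v * (f v ^ 2 - 2 * lam * (v * f v)
        + (1 + lam * α 1 * v + lam * (lam + 1) / 2 * ω 2 * v ^ 2)) := by
    intro v hv
    obtain ⟨-, j0, j1, j2⟩ := hG.integral_eq hμ hP hJ hv
    have him := hG.im_f v hv
    have i0 := (integrable_pow_mul_sub_cpow hm him 0 (-lam)).const_mul (f v ^ 2)
    have i1 := (integrable_pow_mul_sub_cpow hm him 1 (-lam)).const_mul (2 * f v)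
    simp only [show 2 - lam = -lam + 2 by ring, sub_sq_mul_sub_cpow him _ (-lam)]
    refine (integral_add (i0.sub i1) (integrable_pow_mul_sub_cpow hm him 2 _)).trans ?_
    rw [integral_sub' i0 i1,
      integral_const_mul, integral_const_mul, j0, j1, j2]
    ring
  have hint1 : ∫ x : ℝ, (f z - (x : ℂ)) ^ ((1 - lam : ℝ) : ℂ) ∂μ = u z * (f z - lam * z) := by
    obtain ⟨-, j0, j1, -⟩ := hG.integral_eq hμ hP hJ hz
    have him := hG.im_f z hz
    simp only [show 1 - lam = -lam + 1 by ring, sub_mul_sub_cpow him _ (-lam)]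
    rw [integral_sub ((integrable_pow_mul_sub_cpow hm him 0 _).const_mul _)
      (integrable_pow_mul_sub_cpow hm him 1 _), integral_const_mul, j0, j1]
    ring
  have h1 := (hasDerivAt_integral_sub_cpow hm (hG.im_f z hz) (2 - lam)).comp z hf
  have hid := hasDerivAt_id z
  have h2 := hu.mul (((hf.pow 2).sub ((hid.mul hf).const_mul (2 * lam : ℂ))).add
    (((hid.const_mul (lam * α 1 : ℂ)).const_add 1).add
      ((hid.pow 2).const_mul (lam * (lam + 1) / 2 * ω 2 : ℂ))))
  have h3 : (fun v => u v * (f v ^ 2 - 2 * lam * (v * f v)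
        + (1 + lam * α 1 * v + lam * (lam + 1) / 2 * ω 2 * v ^ 2))) =ᶠ[𝓝 z]
      ((fun w : ℂ => ∫ x : ℝ, (w - (x : ℂ)) ^ ((2 - lam : ℝ) : ℂ) ∂μ) ∘ f) := by
    filter_upwards [hG.region.isOpen.mem_nhds hz] with v hv
    exact (hint v hv).symm
  have h4 := h2.unique (h1.congr_of_eventuallyEq h3)
  rw [integral_const_mul, show 2 - lam - 1 = 1 - lam by ring, hint1] at h4
  have hu0 := (hG.integral_eq hμ hP hJ hz).1
  have h5 := hG.deriv_u hμ hP hJ hz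
  have hl : (lam : ℂ) ≠ 0 := by exact_mod_cast hlam
  simp [Pi.mul_apply, Pi.add_apply, Pi.sub_apply, Pi.pow_apply] at h4
  generalize deriv u z = du at *
  generalize deriv f z = df at *
  generalize u z = U at *
  generalize f z = F at *
  apply mul_left_cancel₀ (mul_ne_zero hl hu0)
  linear_combination (F - lam * z) * h4 - (F ^ 2 - 2 * lam * (z * F)
        + (1 + lam * α 1 * z + lam * (lam + 1) / 2 * ω 2 * z ^ 2)) * h5

end ODE

/-! ### The parameters -/

lemma quartic_coeffs_eq_zero {S : Set ℂ} (hS : S.Infinite) {c0 c1 c2 c3 c4 : ℂ}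
    (h : ∀ z ∈ S, c0 + c1 * z + c2 * z ^ 2 + c3 * z ^ 3 + c4 * z ^ 4 = 0) :
    c1 = 0 ∧ c2 = 0 ∧ c3 = 0 ∧ c4 = 0 := by
  set p : ℂ[X] := Polynomial.C c0 + Polynomial.C c1 * Polynomial.X +
    Polynomial.C c2 * Polynomial.X ^ 2 + Polynomial.C c3 * Polynomial.X ^ 3 +
    Polynomial.C c4 * Polynomial.X ^ 4 with hp
  have hp0 : p = 0 := Polynomial.eq_zero_of_infinite_isRoot p
    (hS.mono fun z hz => by simpa [hp, Polynomial.IsRoot] using h z hz)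
  have hc := fun n => congrArg (fun q : ℂ[X] => q.coeff n) hp0
  refine ⟨?_, ?_, ?_, ?_⟩
  · simpa [hp, Polynomial.coeff_X, Polynomial.coeff_C] using hc 1
  · simpa [hp, Polynomial.coeff_X, Polynomial.coeff_C] using hc 2
  · simpa [hp, Polynomial.coeff_X, Polynomial.coeff_C] using hc 3
  · simpa [hp, Polynomial.coeff_X, Polynomial.coeff_C] using hc 4

lemma IsCutRegion.ne_zero {S : Set ℂ} (hS : IsCutRegion S) {z : ℂ} (hz : z ∈ S) : z ≠ 0 :=
  Complex.slitPlane_ne_zero (hS.cut hz)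

lemma IsCutRegion.neBot {S : Set ℂ} (hS : IsCutRegion S) : (𝓝[S] (0 : ℂ)).NeBot := by
  obtain ⟨z, hz⟩ := hS.nonempty
  rw [← mem_closure_iff_nhdsWithin_neBot]
  exact closure_mono (connectedComponentIn_subset S z) (hS.near_zero z hz)

/-- The real solutions of the coefficient equations of the Riccati equation for
`f = A z + B + 1 / z` with `A = (lam + 1) ^ 2 om / (4 lam)`, `B = (lam + 1) al / 2`. -/
lemma solve_parameters {lam al om : ℝ} (hlam : 1 / 2 < lam) (hlam1 : lam ≠ 1)
    (h2 : (1 - (lam + 1) ^ 2 * om / (4 * lam)) + (lam * (lam + 1) / 2 * om - lam ^ 2) =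
      2 * ((lam + 1) ^ 2 * om / (4 * lam)) + ((lam + 1) * al / 2) ^ 2
        - (lam + 1) * al / 2 * al - (lam + 1) * om)
    (h4 : (1 - (lam + 1) ^ 2 * om / (4 * lam)) * (lam * (lam + 1) / 2 * om - lam ^ 2) =
      ((lam + 1) ^ 2 * om / (4 * lam)) ^ 2 - lam ^ 2
        - ((lam + 1) ^ 2 * om / (4 * lam) - lam) * (lam + 1) * om) :
    om = 2 * lam ^ 3 / ((lam + 1) ^ 2 * (lam - 1 / 2)) ∧
      al ^ 2 = 2 / ((lam + 1) ^ 2 * (lam - 1 / 2)) := by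
  have hl : 0 < lam := by linarith
  have hl1 : 0 < lam + 1 := by linarith
  have hh : 0 < lam - 1 / 2 := by linarith
  have h1l : lam - 1 ≠ 0 := sub_ne_zero.2 hlam1
  obtain ⟨A, hA⟩ : ∃ A, A = (lam + 1) ^ 2 * om / (4 * lam) := ⟨_, rfl⟩
  have hom : om = 4 * lam * A / (lam + 1) ^ 2 := by
    rw [hA]; field_simp
  rw [← hA] at h2 h4
  rw [hom] at h2 h4
  have h4' : A * (lam - 1) * (lam ^ 2 - (2 * lam - 1) * A) = 0 := by
    field_simp at h4
    linear_combination h4 / 2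
  have h2' : (lam - 1) * ((lam + 1) ^ 2 * (al ^ 2 + 4)) =
      4 * A * (2 * lam ^ 2 + lam - 3) := by
    field_simp at h2
    linear_combination -h2
  have h2'' : (lam + 1) ^ 2 * (al ^ 2 + 4) = 4 * A * (2 * lam + 3) :=
    mul_left_cancel₀ h1l (by linear_combination h2')
  -- the quadratic equation for `A` has the spurious root `0`, excluded because `al` is real
  have hA0 : A ≠ 0 := by
    rintro rfl
    have : 0 < (lam + 1) ^ 2 * (al ^ 2 + 4) := by positivity
    linarith
  have hAval : (2 * lam - 1) * A = lam ^ 2 := by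
    have := (mul_eq_zero.1 h4').resolve_left (mul_ne_zero hA0 h1l)
    linarith
  have hAeq : A = lam ^ 2 / (2 * (lam - 1 / 2)) := by
    rw [eq_div_iff (by positivity)]
    linarith
  constructor
  · rw [hom, hAeq]
    field_simp
    ring
  · rw [eq_div_iff (by positivity)]
    linear_combination (lam - 1 / 2) * h2'' + (4 * lam + 6) * hAval

section

variable {lam : ℝ} {μ : Measure ℝ} {P : ℕ → ℝ[X]} {α ω : ℕ → ℝ} {S : Set ℂ} {f u : ℂ → ℂ}

/-- Comparison of coefficients in the Riccati equation determines all the parameters. -/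
theorem HasUltrasphericalGF.parameters (hG : HasUltrasphericalGF lam μ P S f u)
    (hlam : 1 / 2 < lam) (hlam1 : lam ≠ 1) (hμ : IsStandard μ) (hP : IsMonicOPS μ P)
    (hJ : IsJacobiSzego P α ω) (hα : α 1 ≠ 0) {a₀ a₁ a₂ : ℂ}
    (hg : ∀ z ∈ S, gFun lam (α 1) (ω 2) f z = (a₀ * z ^ 2 + a₁ * z + a₂) / z) :
    ω 2 = 2 * lam ^ 3 / ((lam + 1) ^ 2 * (lam - 1 / 2)) ∧
      (α 1) ^ 2 = 2 / ((lam + 1) ^ 2 * (lam - 1 / 2)) ∧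
      a₀ = (((1 - lam) * lam ^ 2 / ((lam + 1) * (2 * lam - 1)) : ℝ) : ℂ) ∧
      a₁ = ((lam * α 1 / 2 : ℝ) : ℂ) ∧ a₂ = 1 := by
  have hl : 0 < lam := by linarith
  have hl1 : 0 < lam + 1 := by linarith
  set A : ℂ := a₀ + (lam + 1) * ω 2 / 2 with hA
  set B : ℂ := a₁ + α 1 / 2 with hB
  have hf : ∀ z ∈ S, f z = A * z + B + a₂ * z⁻¹ := by
    intro z hz
    have hz0 := hG.region.ne_zero hz
    have h := hg z hz
    rw [gFun, sub_eq_iff_eq_add] at h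
    rw [h, hA, hB]
    field_simp
    ring
  have hf' : ∀ z ∈ S, deriv f z = A - a₂ / z ^ 2 := by
    intro z hz
    have hz0 := hG.region.ne_zero hz
    have h1 : HasDerivAt (fun z => A * z + B + a₂ * z⁻¹) (A - a₂ / z ^ 2) z := by
      have h2 := (((hasDerivAt_id z).const_mul A).add_const B).add
        ((hasDerivAt_inv hz0).const_mul a₂)
      convert! h2 using 1
      simp
      ring
    refine (h1.congr_of_eventuallyEq ?_).deriv
    filter_upwards [hG.region.isOpen.mem_nhds hz] with v hv
    exact hf v hv
  have ha2 : a₂ = 1 := by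
    have := hG.region.neBot
    have h1 : Tendsto (fun z : ℂ => A * z ^ 2 + B * z + a₂) (𝓝[S] 0) (𝓝 a₂) := by
      have h2 : Continuous fun z : ℂ => A * z ^ 2 + B * z + a₂ := by fun_prop
      have h3 := (h2.tendsto 0).mono_left (nhdsWithin_le_nhds (s := S))
      simpa using h3
    refine tendsto_nhds_unique (h1.congr' ?_) hG.lim_f
    filter_upwards [self_mem_nhdsWithin] with z hz
    have hz0 := hG.region.ne_zero hz
    rw [hf z hz]
    field_simp
  have hinf : S.Infinite := by
    obtain ⟨z, hz⟩ := hG.region.nonempty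
    exact infinite_of_mem_nhds z (hG.region.isOpen.mem_nhds hz)
  have hquart : ∀ z ∈ S, (0 : ℂ) + (lam * α 1 - (2 * B - α 1)) * z
      + ((1 - A) + (lam * (lam + 1) / 2 * ω 2 - lam ^ 2) -
        (2 * A + B ^ 2 - B * α 1 - (lam + 1) * ω 2)) * z ^ 2
      + ((1 - A) * lam * α 1 - (2 * A * B - (A - lam) * α 1 - B * (lam + 1) * ω 2)) * z ^ 3
      + ((1 - A) * (lam * (lam + 1) / 2 * ω 2 - lam ^ 2)
        - (A ^ 2 - lam ^ 2 - (A - lam) * (lam + 1) * ω 2)) * z ^ 4 = 0 := by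
    intro z hz
    have hz0 := hG.region.ne_zero hz
    have h1 := hG.riccati hl.ne' hμ hP hJ hz
    rw [hf' z hz, hf z hz, ha2] at h1
    field_simp at h1
    linear_combination h1 / 2
  -- `e1` gives `B`, `e3` then gives `A` (here `α 1 ≠ 0` is needed), and `e2`, `e4` are the two
  -- equations that remain for `α 1` and `ω 2`
  obtain ⟨e1, e2, e3, e4⟩ := quartic_coeffs_eq_zero hinf hquart
  have hlC : (lam : ℂ) ≠ 0 := by exact_mod_cast hl.ne'
  have hl1C : (lam : ℂ) + 1 ≠ 0 := by exact_mod_cast hl1.ne'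
  have hαC : (α 1 : ℂ) ≠ 0 := by exact_mod_cast hα
  have hBval : B = (((lam + 1) * α 1 / 2 : ℝ) : ℂ) := by
    push_cast
    linear_combination (-1 / 2 : ℂ) * e1
  have hAval : A = (((lam + 1) ^ 2 * ω 2 / (4 * lam) : ℝ) : ℂ) := by
    push_cast
    rw [eq_div_iff (by simpa using hlC)]
    apply mul_left_cancel₀ hαC
    rw [hBval] at e3
    push_cast at e3
    linear_combination (-2 : ℂ) * e3
  rw [hAval, hBval] at e2
  rw [hAval] at e4
  have r := solve_parameters (al := α 1) (om := ω 2) hlam hlam1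
    (by have h := sub_eq_zero.1 e2; exact_mod_cast h)
    (by have h := sub_eq_zero.1 e4; exact_mod_cast h)
  refine ⟨r.1, r.2, ?_, ?_, ha2⟩
  · have h1 : a₀ = A - (lam + 1) * ω 2 / 2 := by rw [hA]; ring
    rw [h1, hAval, r.1]
    rw [show (((lam : ℂ) + 1) * ((2 * lam ^ 3 / ((lam + 1) ^ 2 * (lam - 1 / 2)) : ℝ) : ℂ) / 2) =
      (((lam + 1) * (2 * lam ^ 3 / ((lam + 1) ^ 2 * (lam - 1 / 2))) / 2 : ℝ) : ℂ) by
        push_cast; ring,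
      ← Complex.ofReal_sub]
    congr 1
    have hh : lam - 1 / 2 ≠ 0 := by linarith
    have hh' : 2 * lam - 1 ≠ 0 := by linarith
    rw [show lam - 1 / 2 = (2 * lam - 1) / 2 by ring]
    field_simp
    ring
  · have h1 : a₁ = B - α 1 / 2 := by rw [hB]; ring
    rw [h1, hBval]
    push_cast
    ring

/-- The resulting formula for `f`, where `eps` is the sign of `α 1`. -/
theorem HasUltrasphericalGF.f_eq (hG : HasUltrasphericalGF lam μ P S f u)
    (hlam : 1 / 2 < lam) (hlam1 : lam ≠ 1) (hμ : IsStandard μ) (hP : IsMonicOPS μ P)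
    (hJ : IsJacobiSzego P α ω) {eps : ℝ} (heps : eps = 1 ∨ eps = -1) (hα : 0 < eps * α 1)
    {a₀ a₁ a₂ : ℂ} (hg : ∀ z ∈ S, gFun lam (α 1) (ω 2) f z = (a₀ * z ^ 2 + a₁ * z + a₂) / z)
    {z : ℂ} (hz : z ∈ S) :
    f z = ((lam ^ 2 / (2 * lam - 1) : ℝ) : ℂ) * z + ((eps / √(2 * lam - 1) : ℝ) : ℂ) + z⁻¹ := by
  have hα0 : α 1 ≠ 0 := by
    rintro h
    rw [h, mul_zero] at hα
    exact lt_irrefl _ hα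
  obtain ⟨hom, hal, ha0, ha1, ha2⟩ := hG.parameters hlam hlam1 hμ hP hJ hα0 hg
  have hz0 := hG.region.ne_zero hz
  have hl1 : 0 < lam + 1 := by linarith
  have hh : 0 < 2 * lam - 1 := by linarith
  have hr : 0 < √(2 * lam - 1) := Real.sqrt_pos.2 hh
  have hsq : eps ^ 2 = 1 := by rcases heps with rfl | rfl <;> norm_num
  have hal2 : α 1 = eps * (2 / ((lam + 1) * √(2 * lam - 1))) := by
    have h1 : (eps * α 1) ^ 2 = (2 / ((lam + 1) * √(2 * lam - 1))) ^ 2 := by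
      rw [mul_pow, hsq, hal, div_pow, mul_pow, Real.sq_sqrt hh.le,
        show lam - 1 / 2 = (2 * lam - 1) / 2 by ring]
      field_simp
    have h2 := (pow_left_inj₀ hα.le (by positivity) two_ne_zero).1 h1
    rw [← h2, ← mul_assoc, ← sq, hsq, one_mul]
  have h := hg z hz
  rw [gFun, sub_eq_iff_eq_add, ha0, ha1, ha2, hom] at h
  have e1 : lam ^ 2 / (2 * lam - 1) = (1 - lam) * lam ^ 2 / ((lam + 1) * (2 * lam - 1))
      + (lam + 1) * (2 * lam ^ 3 / ((lam + 1) ^ 2 * (lam - 1 / 2))) / 2 := by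
    rw [show lam - 1 / 2 = (2 * lam - 1) / 2 by ring]
    field_simp
    ring
  have e2 : eps / √(2 * lam - 1) = lam * α 1 / 2 + α 1 / 2 := by
    rw [hal2]
    field_simp
  rw [h, e1, e2]
  push_cast
  generalize (1 - (lam : ℂ)) * lam ^ 2 / ((lam + 1) * (2 * lam - 1)) = X
  generalize 2 * (lam : ℂ) ^ 3 / ((lam + 1) ^ 2 * (lam - 1 / 2)) = Y
  field_simp
  ring

end

/-! ### The region, and the function `u` -/

/-- If `Im z` and `Im w` have opposite signs, then so do the arguments, and no branch cut is
crossed. -/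
lemma mul_cpow_of_im_mul_im_neg {z w : ℂ} (h : z.im * w.im < 0) (c : ℂ) :
    (z * w) ^ c = z ^ c * w ^ c := by
  have key : ∀ z w : ℂ, 0 < z.im → w.im < 0 → (z * w) ^ c = z ^ c * w ^ c := by
    intro z w hz hw
    have hz0 : z ≠ 0 := by rintro rfl; simp at hz
    have hw0 : w ≠ 0 := by rintro rfl; simp at hw
    have h1 := Complex.arg_nonneg_iff.2 hz.le
    have h2 := Complex.arg_neg_iff.2 hw
    exact mul_cpow_of_arg hz0 hw0
      ⟨by linarith [Complex.neg_pi_lt_arg w], by linarith [Complex.arg_le_pi z]⟩ c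
  rcases lt_or_gt_of_ne (show z.im ≠ 0 by rintro h0; rw [h0, zero_mul] at h; exact lt_irrefl _ h)
    with hz | hz
  · rw [mul_comm z w, mul_comm (z ^ c)]
    exact key w z (by by_contra hw; push Not at hw; nlinarith) hz
  · exact key z w hz (by by_contra hw; push Not at hw; nlinarith)

/-- The imaginary part of `A z + b + 1 / z` for real `A`, `b`. -/
lemma im_mul_add_add_inv (A b : ℝ) (z : ℂ) :
    ((A : ℂ) * z + (b : ℂ) + z⁻¹).im = z.im * (A - (Complex.normSq z)⁻¹) := by
  simp [Complex.inv_im]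
  ring

/-- On each component of the region, `Im z` and `Im f` have opposite signs: their product does not
vanish, and it is negative near `0`. -/
lemma IsCutRegion.im_mul_im_neg {S : Set ℂ} (hS : IsCutRegion S) {A b : ℝ} (hA : 0 < A)
    (him : ∀ z ∈ S, ((A : ℂ) * z + (b : ℂ) + z⁻¹).im ≠ 0) {z : ℂ} (hz : z ∈ S) :
    z.im * ((A : ℂ) * z + (b : ℂ) + z⁻¹).im < 0 := by
  set g : ℂ → ℝ := fun v => v.im * ((A : ℂ) * v + (b : ℂ) + v⁻¹).im with hg
  have hsub := connectedComponentIn_subset S z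
  have hne : ∀ v ∈ S, g v ≠ 0 := by
    intro v hv h0
    have h1 := him v hv
    rw [im_mul_add_add_inv] at h1
    simp only [hg, im_mul_add_add_inv] at h0
    rcases mul_eq_zero.1 h0 with h | h
    · exact (mul_ne_zero_iff.1 h1).1 h
    · exact h1 h
  have hcont : ContinuousOn g (connectedComponentIn S z) := by
    intro v hv
    have hv0 := hS.ne_zero (hsub hv)
    refine ContinuousAt.continuousWithinAt ?_
    have h1 : ContinuousAt (fun v : ℂ => (A : ℂ) * v + (b : ℂ) + v⁻¹) v := by
      fun_prop (disch := assumption)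
    exact Complex.continuous_im.continuousAt.mul (Complex.continuous_im.continuousAt.comp h1)
  obtain ⟨v, hv, hvs⟩ := Metric.mem_closure_iff.1 (hS.near_zero z hz) (√A)⁻¹ (by positivity)
  have hv0 := hS.ne_zero (hsub hv)
  have hgv : g v < 0 := by
    rw [dist_zero_left] at hvs
    have h1 : 0 < Complex.normSq v := Complex.normSq_pos.2 hv0
    have h2 : Complex.normSq v < A⁻¹ := by
      rw [Complex.normSq_eq_norm_sq, ← Real.sq_sqrt (inv_pos.2 hA).le, Real.sqrt_inv]
      exact pow_lt_pow_left₀ hvs (norm_nonneg v) two_ne_zero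
    have h3 : A < (Complex.normSq v)⁻¹ := (lt_inv_comm₀ h1 hA).1 h2
    have h4 : v.im ≠ 0 := fun h => hne v (hsub hv) (by simp [hg, h])
    have h5 : 0 < v.im ^ 2 := by positivity
    simp only [hg, im_mul_add_add_inv]
    nlinarith
  by_contra hcon
  push Not at hcon
  have h0 := isPreconnected_connectedComponentIn.intermediate_value hv
    (mem_connectedComponentIn hz) hcont
  obtain ⟨v', hv', hv0'⟩ := h0 ⟨hgv.le, hcon⟩
  exact hne v' (hsub hv') hv0'

section

variable {lam : ℝ} {μ : Measure ℝ} {P : ℕ → ℝ[X]} {α ω : ℕ → ℝ} {S : Set ℂ} {f u : ℂ → ℂ}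

/-- The logarithmic differential equation for `u` integrates explicitly; the constant is fixed on
each component of the region by the behaviour at `0`. Here `s = eps / √(2 lam - 1)`. -/
theorem HasUltrasphericalGF.u_mul_eq (hG : HasUltrasphericalGF lam μ P S f u)
    (hlam : 1 / 2 < lam) {s : ℝ} (hs : s ^ 2 * (2 * lam - 1) = 1)
    (hμ : IsStandard μ) (hP : IsMonicOPS μ P) (hJ : IsJacobiSzego P α ω)
    (hf : ∀ z ∈ S, f z = ((lam ^ 2 / (2 * lam - 1) : ℝ) : ℂ) * z + (s : ℂ) + z⁻¹)
    {z : ℂ} (hz : z ∈ S) : u z * (1 + lam * s * z) = z ^ (lam : ℂ) := by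
  have hA : lam ^ 2 / (2 * lam - 1) = lam ^ 2 * s ^ 2 := by
    rw [div_eq_iff (by linarith)]
    linear_combination (-lam ^ 2) * hs
  rw [hA] at hf
  have hsC : (s : ℂ) ^ 2 * (2 * lam - 1) = 1 := by exact_mod_cast hs
  set T := connectedComponentIn S z with hT
  have hTS : T ⊆ S := connectedComponentIn_subset S z
  have hTo : IsOpen T := hG.region.isOpen.connectedComponentIn
  have him : ∀ v ∈ S, v.im ≠ 0 := by
    intro v hv h
    have := hG.im_f v hv
    rw [hf v hv, im_mul_add_add_inv, h, zero_mul] at this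
    exact this rfl
  -- `W` is locally constant, and tends to `1` at `0`
  set W : ℂ → ℂ := fun v => u v * (1 + lam * s * v) * v ^ (-(lam : ℂ)) with hW
  have hder : ∀ v ∈ S, HasDerivAt W 0 v := by
    intro v hv
    have hv0 := hG.region.ne_zero hv
    have hu := (hG.analytic_u v hv).differentiableAt.hasDerivAt
    have h1 : HasDerivAt (fun v : ℂ => 1 + lam * s * v) (lam * s : ℂ) v := by
      simpa using ((hasDerivAt_id v).const_mul (lam * s : ℂ)).const_add 1
    have h2 := ((hasDerivAt_id v).cpow_const (c := -(lam : ℂ)) (hG.region.cut hv))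
    have h3 := (hu.mul h1).mul h2
    convert! h3 using 1
    have hf' : deriv f v = lam ^ 2 * s ^ 2 - 1 / v ^ 2 := by
      have h4 : HasDerivAt (fun v : ℂ => ((lam ^ 2 * s ^ 2 : ℝ) : ℂ) * v + (s : ℂ) + v⁻¹)
          (lam ^ 2 * s ^ 2 - 1 / v ^ 2) v := by
        have h5 := (((hasDerivAt_id v).const_mul ((lam ^ 2 * s ^ 2 : ℝ) : ℂ)).add_const
          (s : ℂ)).add (hasDerivAt_inv hv0)
        convert! h5 using 1
        simp
        ring
      refine (h4.congr_of_eventuallyEq ?_).deriv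
      filter_upwards [hG.region.isOpen.mem_nhds hv] with v' hv'
      exact hf v' hv'
    have hode := hG.deriv_u hμ hP hJ hv
    rw [hf', hf v hv] at hode
    have hv1 : v * v⁻¹ = 1 := mul_inv_cancel₀ hv0
    have hode1 : deriv u v * v * (lam ^ 2 * s ^ 2 * v ^ 2 + s * v + 1 - lam * v ^ 2) =
        lam * u v * (v ^ 2 - lam ^ 2 * s ^ 2 * v ^ 2 + 1) := by
      rw [one_div, ← inv_pow] at hode
      push_cast at hode
      linear_combination v ^ 2 * hode - (deriv u v * v) * hv1
        + lam * u v * (v * v⁻¹ + 1) * hv1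
    -- both sides of the equation share the factor `1 + (1 - lam) s v`
    have hfac : (1 + (1 - lam) * s * v : ℂ) ≠ 0 := by
      intro h0
      have h6 := congrArg Complex.im h0
      rw [show (1 + (1 - lam) * s * v : ℂ) = 1 + (((1 - lam) * s : ℝ) : ℂ) * v by
        push_cast; ring, Complex.add_im, Complex.im_ofReal_mul, Complex.one_im, zero_add,
        Complex.zero_im] at h6
      have h7 := (mul_eq_zero.1 h6).resolve_right (him v hv)
      rw [show (1 + (1 - lam) * s * v : ℂ) = 1 + (((1 - lam) * s : ℝ) : ℂ) * v by
        push_cast; ring, h7] at h0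
      simp at h0
    have hode2 : deriv u v * v * (1 + lam * s * v) = lam * u v * (1 - (1 - lam) * s * v) := by
      apply mul_left_cancel₀ hfac
      linear_combination hode1 - (deriv u v * v ^ 3 * lam + lam * u v * v ^ 2) * hsC
    simp only [id_eq, mul_one, Pi.mul_apply]
    rw [Complex.cpow_sub _ _ hv0, Complex.cpow_one]
    field_simp
    linear_combination (-v ^ (-(lam : ℂ))) * hode2
  have hconst : ∀ v ∈ T, W v = W z := fun v hv =>
    hTo.is_const_of_deriv_eq_zero isPreconnected_connectedComponentIn
      (fun v hv => (hder v (hTS hv)).differentiableAt.differentiableWithinAt)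
      (fun v hv => (hder v (hTS hv)).deriv) hv (mem_connectedComponentIn hz)
  have hbot : (𝓝[T] (0 : ℂ)).NeBot :=
    mem_closure_iff_nhdsWithin_neBot.1 (hG.region.near_zero z hz)
  have hlim : Tendsto (fun v => u v / v ^ (lam : ℂ) * (1 + lam * s * v)) (𝓝[T] 0) (𝓝 1) := by
    have h1 : Tendsto (fun v : ℂ => (1 + lam * s * v : ℂ)) (𝓝[T] 0) (𝓝 1) := by
      have h2 : Continuous fun v : ℂ => (1 + lam * s * v : ℂ) := by fun_prop
      have h3 := (h2.tendsto 0).mono_left (nhdsWithin_le_nhds (s := T))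
      simpa using h3
    simpa using (hG.lim_u.mono_left (nhdsWithin_mono 0 hTS)).mul h1
  have hWz : W z = 1 := by
    refine tendsto_nhds_unique (tendsto_const_nhds.congr' ?_) hlim
    filter_upwards [self_mem_nhdsWithin] with v hv
    rw [← hconst v hv, hW]
    simp only [Complex.cpow_neg]
    ring
  have hz0 := hG.region.ne_zero hz
  have hpow : z ^ (lam : ℂ) ≠ 0 := by
    rw [Ne, Complex.cpow_eq_zero_iff]
    exact fun h => hz0 h.1
  simp only [hW, Complex.cpow_neg] at hWz
  field_simp at hWz
  linear_combination hWz

end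

/-! ### Uniqueness of power series -/

/-- A power series vanishing at points accumulating at `0` is zero. -/
lemma eq_zero_of_frequently_hasSum {d : ℕ → ℂ}
    (h : ∃ᶠ z in 𝓝[≠] (0 : ℂ), HasSum (fun n => d n * z ^ n) 0) (n : ℕ) : d n = 0 := by
  obtain ⟨z₁, hz₁, hne⟩ := (h.and_eventually self_mem_nhdsWithin).exists
  set p := FormalMultilinearSeries.ofScalars ℂ d with hp
  have hrad : 0 < p.radius := by
    have h1 : ((‖z₁‖₊ : NNReal) : ENNReal) ≤ p.radius := by
      refine p.le_radius_of_tendsto (l := 0) ?_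
      have h2 := hz₁.summable.tendsto_atTop_zero.norm
      rw [norm_zero] at h2
      refine h2.congr fun n => ?_
      rw [hp, norm_mul, norm_pow, FormalMultilinearSeries.ofScalars_norm]
      rfl
    refine lt_of_lt_of_le ?_ h1
    simpa using hne
  have hps := p.hasFPowerSeriesOnBall hrad
  have hsum : ∀ z, p.sum z = ∑' n, d n * z ^ n := by
    intro z
    rw [FormalMultilinearSeries.sum]
    refine tsum_congr fun n => ?_
    rw [hp, FormalMultilinearSeries.ofScalars_apply_eq]
    simp
  have hfreq : ∃ᶠ z in 𝓝[≠] (0 : ℂ), p.sum z = 0 := h.mono fun z hz => by rw [hsum, hz.tsum_eq]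
  have hev := hps.analyticAt.frequently_zero_iff_eventually_zero.1 hfreq
  have h0 : p = 0 := (hps.hasFPowerSeriesAt.congr hev).eq_zero
  have h1 := congrArg (fun q : FormalMultilinearSeries ℂ ℂ ℂ => q.coeff n) h0
  simp only [hp, FormalMultilinearSeries.coeff_ofScalars] at h1
  rw [h1, FormalMultilinearSeries.coeff]
  simp

/-! ### The generating function -/

/-- Where `Im z` and `Im f` have opposite signs, the principal powers of `z` and `f - x` multiply
to the principal power of `z (f - x)`. -/
lemma one_div_mul_cpow_eq {lam A s : ℝ} {z U : ℂ} (hz : z ≠ 0)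
    (hU : U * (1 + lam * s * z) = z ^ (lam : ℂ))
    (him : z.im * ((A : ℂ) * z + (s : ℂ) + z⁻¹).im < 0) (x : ℝ) :
    1 / (U * ((A : ℂ) * z + (s : ℂ) + z⁻¹ - (x : ℂ)) ^ (lam : ℂ)) =
      (1 + lam * s * z) * (1 - z * ((x : ℂ) - s) + A * z ^ 2) ^ (-(lam : ℂ)) := by
  have hpow : z ^ (lam : ℂ) ≠ 0 := by
    rw [Ne, Complex.cpow_eq_zero_iff]
    exact fun h => hz h.1
  have hU0 : U ≠ 0 := by
    rintro rfl
    rw [zero_mul] at hU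
    exact hpow hU.symm
  have hprod : 1 - z * ((x : ℂ) - s) + A * z ^ 2 =
      z * ((A : ℂ) * z + (s : ℂ) + z⁻¹ - (x : ℂ)) := by
    field_simp
    ring
  have him' : z.im * ((A : ℂ) * z + (s : ℂ) + z⁻¹ - (x : ℂ)).im < 0 := by
    rwa [Complex.sub_im, Complex.ofReal_im, sub_zero]
  rw [hprod, mul_cpow_of_im_mul_im_neg him', Complex.cpow_neg, Complex.cpow_neg, ← hU]
  have hU1 : (1 + lam * s * z : ℂ) ≠ 0 := by
    intro h
    rw [h, mul_zero] at hU
    exact hpow hU.symm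
  rw [one_div, mul_inv, mul_inv, mul_right_comm U⁻¹,
    mul_comm (1 + lam * s * z : ℂ), inv_mul_cancel_right₀ hU1]

/-- In the generating function, the polynomials `shiftedJacobi` become `C_n + eps C_{n-1}` with `z`
scaled by `lam / √(2 lam - 1)`. -/
lemma coeff_mul_eval_shiftedJacobi {lam eps : ℝ} (hlam : 1 / 2 < lam)
    (heps : eps = 1 ∨ eps = -1) (n : ℕ) (x : ℝ) :
    coeff lam n * (shiftedJacobi lam eps n).eval x =
      (lam / √(2 * lam - 1)) ^ n *
        gegenbauerComb lam eps (((√(2 * lam - 1) * x - eps) / (2 * lam) - 1) / 2) n := by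
  rw [← coeff_mul_eval_monicJacobi hlam heps, eval_shiftedJacobi,
    show 2 * (((√(2 * lam - 1) * x - eps) / (2 * lam) - 1) / 2) + 1 =
      (√(2 * lam - 1) * x - eps) / (2 * lam) by ring,
    show 2 * lam / √(2 * lam - 1) = 2 * (lam / √(2 * lam - 1)) by ring, mul_pow]
  ring

/-- The generating function of the rescaled Jacobi polynomials, for every real `x` and `z` small. -/
theorem hasSum_shiftedJacobi {lam eps : ℝ} (hlam : 1 / 2 < lam) (heps : eps = 1 ∨ eps = -1)
    (x : ℝ) {z : ℂ} (hz : lam / √(2 * lam - 1) * ‖z‖ *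
      (16 * |((√(2 * lam - 1) * x - eps) / (2 * lam) - 1) / 2| + 4) ≤ 1) :
    HasSum (fun n => ((coeff lam n * (shiftedJacobi lam eps n).eval x : ℝ) : ℂ) * z ^ n)
      ((1 + lam * ((eps / √(2 * lam - 1) : ℝ) : ℂ) * z) *
        (1 - z * ((x : ℂ) - ((eps / √(2 * lam - 1) : ℝ) : ℂ))
          + ((lam ^ 2 / (2 * lam - 1) : ℝ) : ℂ) * z ^ 2) ^ (-(lam : ℂ))) := by
  have hl : 0 < lam := by linarith
  have hr := sqrt_pos_of_half_lt hlam
  have hr2 : √(2 * lam - 1) ^ 2 = 2 * lam - 1 := Real.sq_sqrt (by linarith)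
  set r := √(2 * lam - 1) with hrdef
  set s : ℂ := ((lam / r : ℝ) : ℂ) * z with hs
  have hsn : ‖s‖ = lam / r * ‖z‖ := by
    rw [hs, norm_mul, Complex.norm_real, Real.norm_eq_abs, abs_of_pos (by positivity)]
  have h := hasSum_gegenbauerComb hl eps (((r * x - eps) / (2 * lam) - 1) / 2)
    (s := s) (by rw [hsn]; exact hz)
  have hrC : (r : ℂ) ≠ 0 := by exact_mod_cast hr.ne'
  have hlC : (lam : ℂ) ≠ 0 := by exact_mod_cast hl.ne'
  convert! h using 1
  · funext n
    rw [coeff_mul_eval_shiftedJacobi hlam heps, hs, mul_pow]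
    push_cast
    ring
  · rw [← hr2, hs]
    push_cast
    congr 2
    · ring
    · field_simp
      ring

section

variable {lam : ℝ} {μ : Measure ℝ} {P : ℕ → ℝ[X]} {α ω : ℕ → ℝ} {S : Set ℂ} {f u : ℂ → ℂ}

/-- The classification, uniformly in the sign `eps` of `α 1`. The generating functions of `P` and of
`shiftedJacobi` agree near `0` for each `x` in the support of `μ`; hence so do the polynomials on
the support, then everywhere, and `μ` has the moments of the shifted Beta distribution. -/
theorem HasUltrasphericalGF.classification (hG : HasUltrasphericalGF lam μ P S f u)
    (hlam : 1 / 2 < lam) (hlam1 : lam ≠ 1) (hμ : IsStandard μ) (hP : IsMonicOPS μ P)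
    (hJ : IsJacobiSzego P α ω) {eps : ℝ} (heps : eps = 1 ∨ eps = -1) (hα : 0 < eps * α 1)
    {a₀ a₁ a₂ : ℂ} (hg : ∀ z ∈ S, gFun lam (α 1) (ω 2) f z = (a₀ * z ^ 2 + a₁ * z + a₂) / z) :
    (∀ z ∈ S, f z =
      ((lam ^ 2 / (2 * lam - 1) : ℝ) : ℂ) * z + ((eps / √(2 * lam - 1) : ℝ) : ℂ) + z⁻¹) ∧
    (∀ z ∈ S, u z * (1 + lam * ((eps / √(2 * lam - 1) : ℝ) : ℂ) * z) = z ^ (lam : ℂ)) ∧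
    (∀ z ∈ S, ∀ x ∈ μ.support,
      HasSum (fun n => ((coeff lam n * (P n).eval x : ℝ) : ℂ) * z ^ n)
        ((1 + lam * ((eps / √(2 * lam - 1) : ℝ) : ℂ) * z) *
          (1 - z * ((x : ℂ) - ((eps / √(2 * lam - 1) : ℝ) : ℂ))
            + ((lam ^ 2 / (2 * lam - 1) : ℝ) : ℂ) * z ^ 2) ^ (-(lam : ℂ)))) ∧
    (∀ n, P n = shiftedJacobi lam eps n) ∧
    ∃ c : ℝ, 0 < c ∧ μ = betaMeasureOn c (lam - 1 + eps / 2) (lam - 1 - eps / 2)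
        ((eps - 2 * lam) / √(2 * lam - 1)) ((eps + 2 * lam) / √(2 * lam - 1))
        (fun x => (√(2 * lam - 1) * x - eps) / (2 * lam)) := by
  have hl : 0 < lam := by linarith
  have hh : 0 < 2 * lam - 1 := by linarith
  have hr := sqrt_pos_of_half_lt hlam
  have hprob := hμ.prob
  have hprobν := isProbabilityMeasure_shiftedBeta hlam heps
  have hsq : eps ^ 2 = 1 := by rcases heps with rfl | rfl <;> norm_num
  have hf := fun z hz => hG.f_eq hlam hlam1 hμ hP hJ heps hα hg (z := z) hz
  have hs : (eps / √(2 * lam - 1)) ^ 2 * (2 * lam - 1) = 1 := by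
    rw [div_pow, Real.sq_sqrt hh.le, hsq]
    field_simp
  have hu := fun z hz => hG.u_mul_eq hlam hs hμ hP hJ hf (z := z) hz
  have him : ∀ z ∈ S, ((lam ^ 2 / (2 * lam - 1) : ℝ) * z + ((eps / √(2 * lam - 1) : ℝ) : ℂ)
      + z⁻¹).im ≠ 0 := fun z hz => by rw [← hf z hz]; exact hG.im_f z hz
  have hsum : ∀ z ∈ S, ∀ x ∈ μ.support,
      HasSum (fun n => ((coeff lam n * (P n).eval x : ℝ) : ℂ) * z ^ n)
        ((1 + lam * ((eps / √(2 * lam - 1) : ℝ) : ℂ) * z) *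
          (1 - z * ((x : ℂ) - ((eps / √(2 * lam - 1) : ℝ) : ℂ))
            + ((lam ^ 2 / (2 * lam - 1) : ℝ) : ℂ) * z ^ 2) ^ (-(lam : ℂ))) := by
    intro z hz x hx
    have h := hG.hasSum z hz x hx
    rwa [hf z hz, one_div_mul_cpow_eq (hG.region.ne_zero hz) (hu z hz)
      (hG.region.im_mul_im_neg (by positivity) him hz)] at h
  have hPx : ∀ n, ∀ x ∈ μ.support, (P n).eval x = (shiftedJacobi lam eps n).eval x := by
    intro n x hx
    have hbot := hG.region.neBot
    set K := lam / √(2 * lam - 1) *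
      (16 * |((√(2 * lam - 1) * x - eps) / (2 * lam) - 1) / 2| + 4) with hK
    have hsmall : ∀ᶠ z in 𝓝[S] (0 : ℂ), K * ‖z‖ < 1 := by
      have h1 : Continuous fun z : ℂ => K * ‖z‖ := by fun_prop
      have h2 := (h1.tendsto 0).mono_left (nhdsWithin_le_nhds (s := S))
      simp only [norm_zero, mul_zero] at h2
      exact h2.eventually_lt_const zero_lt_one
    have hfreq : ∃ᶠ z in 𝓝[≠] (0 : ℂ), HasSum (fun n =>
        (((coeff lam n * (P n).eval x : ℝ) : ℂ)
          - ((coeff lam n * (shiftedJacobi lam eps n).eval x : ℝ) : ℂ)) * z ^ n) 0 := by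
      have h1 : ∀ᶠ z in 𝓝[S] (0 : ℂ), HasSum (fun n =>
          (((coeff lam n * (P n).eval x : ℝ) : ℂ)
            - ((coeff lam n * (shiftedJacobi lam eps n).eval x : ℝ) : ℂ)) * z ^ n) 0 := by
        filter_upwards [hsmall, self_mem_nhdsWithin] with z hz hzS
        have h2 := (hsum z hzS x hx).sub (hasSum_shiftedJacobi hlam heps x (z := z) (by
          rw [hK] at hz; linarith))
        rw [sub_self] at h2
        simpa only [sub_mul] using h2
      exact h1.frequently.filter_mono
        (nhdsWithin_mono 0 fun z hz => hG.region.ne_zero hz)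
    have h3 := eq_zero_of_frequently_hasSum hfreq n
    rw [sub_eq_zero] at h3
    exact mul_left_cancel₀ (coeff_pos hl n).ne' (Complex.ofReal_injective h3)
  have hmν := integrable_pow_shiftedBeta hlam heps
  have hOPS := isMonicOPS_shiftedJacobi hlam heps
  obtain ⟨α', ω', hJ', hω'⟩ := hOPS.exists_isJacobiSzego hmν
    (momentFunctional_shiftedBeta_mul_self_pos hlam heps)
  have hPn : ∀ n, P n = shiftedJacobi lam eps n := hP.eq_of_ae_eq hμ.moments hJ' hω' fun n => by
    filter_upwards [Measure.support_mem_ae (μ := μ)] with x hx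
    exact hPx n x hx
  refine ⟨hf, hu, hsum, hPn, ?_⟩
  have hPfun : P = shiftedJacobi lam eps := funext hPn
  have hμν : μ = shiftedBeta lam eps := by
    refine eq_of_momentFunctional_eq (M := (2 * lam + 1) / √(2 * lam - 1)) (by positivity) ?_
      hμ.moments hmν (hP.momentFunctional_eq hμ.moments hmν (hPfun ▸ hOPS))
    filter_upwards [ae_shiftedBeta hlam] with x hx
    exact abs_le_of_shiftedBeta hlam heps hx
  rw [hμν]
  exact shiftedBeta_eq_betaMeasureOn hlam heps

end

/-! ### Existence for both signs -/

/-- The open upper half disc of radius `δ` about `0`. -/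
def upperHalfDisc (δ : ℝ) : Set ℂ := {z | 0 < z.im ∧ ‖z‖ < δ}

lemma isCutRegion_upperHalfDisc {δ : ℝ} (hδ : 0 < δ) : IsCutRegion (upperHalfDisc δ) := by
  have hmem : ∀ t : ℝ, 0 < t → t < δ → (t : ℂ) * Complex.I ∈ upperHalfDisc δ := by
    intro t ht htδ
    refine ⟨by simpa using ht, ?_⟩
    rwa [norm_mul, Complex.norm_I, mul_one, Complex.norm_real, Real.norm_of_nonneg ht.le]
  have hconv : Convex ℝ (upperHalfDisc δ) := by
    have h : upperHalfDisc δ = {z | 0 < z.im} ∩ Metric.ball 0 δ := by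
      ext z; simp [upperHalfDisc]
    rw [h]
    exact (convex_halfSpace_im_gt 0).inter (convex_ball 0 δ)
  refine ⟨?_, ⟨_, hmem (δ / 2) (by linarith) (by linarith)⟩, ?_, ?_⟩
  · exact (isOpen_lt continuous_const Complex.continuous_im).inter
      (isOpen_lt continuous_norm continuous_const)
  · intro z hz
    exact Or.inr hz.1.ne'
  · intro z hz
    rw [hconv.isPreconnected.connectedComponentIn hz]
    have hcont : Tendsto (fun t : ℝ => (t : ℂ) * Complex.I) (𝓝[>] 0) (𝓝 0) := by
      have h : Continuous fun t : ℝ => (t : ℂ) * Complex.I := by fun_prop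
      simpa using (h.tendsto 0).mono_left nhdsWithin_le_nhds
    refine mem_closure_of_tendsto hcont ?_
    filter_upwards [Ioo_mem_nhdsGT hδ] with t ht
    exact hmem t ht.1 ht.2

/-- A bound for the coefficients that is uniform in `w`, needed to dominate the series. -/
lemma abs_gegenbauerComb_le {lam eps w : ℝ} (hlam : 0 < lam) (heps : |eps| ≤ 1) (hw : |w| ≤ 1)
    (n : ℕ) : |gegenbauerComb lam eps w n| ≤ gegenbauerComb lam 1 1 n := by
  rcases n with _ | n
  · simp [gegenbauerComb]
  · have h1 := abs_gegenbauer_le hlam (n + 1) hw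
    have h2 := abs_gegenbauer_le hlam n hw
    have h3 := abs_add_le (gegenbauer lam (n + 1) w) (eps * gegenbauer lam n w)
    rw [abs_mul] at h3
    have h4 := mul_le_of_le_one_left (abs_nonneg (gegenbauer lam n w)) heps
    simp only [gegenbauerComb]
    linarith

section

variable {lam eps : ℝ}

lemma eval_shiftedJacobi_one (hlam : 1 / 2 < lam) (heps : eps = 1 ∨ eps = -1) (x : ℝ) :
    (shiftedJacobi lam eps 1).eval x = x := by
  have hr := sqrt_pos_of_half_lt hlam
  have hl : 0 < lam := by linarith
  have h := coeff_mul_eval_shiftedJacobi hlam heps 1 x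
  rw [coeff_one] at h
  refine mul_left_cancel₀ hl.ne' (h.trans ?_)
  simp [gegenbauerComb, gegenbauer, Finset.Nat.antidiagonal_succ, coeff_zero, coeff_one]
  generalize √(2 * lam - 1) = r at hr ⊢
  field_simp
  ring

lemma eval_shiftedJacobi_two (hlam : 1 / 2 < lam) (heps : eps = 1 ∨ eps = -1) (x : ℝ) :
    (shiftedJacobi lam eps 2).eval x =
      x ^ 2 - 2 * eps / ((lam + 1) * √(2 * lam - 1)) * x - 1 := by
  have hr := sqrt_pos_of_half_lt hlam
  have hr2 : √(2 * lam - 1) ^ 2 = 2 * lam - 1 := Real.sq_sqrt (by linarith)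
  have hl : 0 < lam := by linarith
  have hsq : eps ^ 2 = 1 := by rcases heps with rfl | rfl <;> norm_num
  have h := coeff_mul_eval_shiftedJacobi hlam heps 2 x
  have hc : 0 < lam * (lam + 1) / 2 := by positivity
  rw [coeff_two] at h
  refine mul_left_cancel₀ hc.ne' (h.trans ?_)
  simp [gegenbauerComb, gegenbauer, Finset.Nat.antidiagonal_succ, coeff_zero, coeff_one, coeff_two]
  set r := √(2 * lam - 1)
  field_simp
  linear_combination 16 * (lam + 1) * hr2 + 16 * (1 - lam) * hsq

lemma isStandard_shiftedBeta (hlam : 1 / 2 < lam) (heps : eps = 1 ∨ eps = -1) :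
    IsStandard (shiftedBeta lam eps) := by
  have hprob := isProbabilityMeasure_shiftedBeta hlam heps
  have hm := integrable_pow_shiftedBeta hlam heps
  have hP := isMonicOPS_shiftedJacobi hlam heps
  have h1 : ∫ x, x ∂(shiftedBeta lam eps) = 0 := by
    have h := hP.orthogonal 1 0 one_ne_zero
    simpa only [hP.zero_eq_one, Polynomial.eval_one, mul_one,
      eval_shiftedJacobi_one hlam heps] using h
  refine ⟨hprob, hm, h1, ?_⟩
  have h := hP.orthogonal 2 0 two_ne_zero
  simp only [hP.zero_eq_one, Polynomial.eval_one, mul_one,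
    eval_shiftedJacobi_two hlam heps] at h
  have hm1 : Integrable (fun x : ℝ => x) (shiftedBeta lam eps) := by simpa using hm 1
  generalize 2 * eps / ((lam + 1) * √(2 * lam - 1)) = k at h
  have hm2 : Integrable (fun x : ℝ => x ^ 2 - k * x) (shiftedBeta lam eps) :=
    (hm 2).sub (hm1.const_mul k)
  rw [integral_sub hm2 (integrable_const _), integral_sub (hm 2) (hm1.const_mul _),
    integral_const_mul, h1] at h
  simp at h
  linarith

/-- The parameter `α 1`, read off from `x P_1 = P_2 + α 1 P_1 + ω 1 P_0`. -/
lemma IsJacobiSzego.alpha_one_eq {α ω : ℕ → ℝ} (hlam : 1 / 2 < lam) (heps : eps = 1 ∨ eps = -1)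
    (hJ : IsJacobiSzego (shiftedJacobi lam eps) α ω) :
    α 1 = 2 * eps / ((lam + 1) * √(2 * lam - 1)) := by
  have h0 : shiftedJacobi lam eps 0 = 1 := (isMonicOPS_shiftedJacobi hlam heps).zero_eq_one
  have h := fun x : ℝ => congrArg (Polynomial.eval x) (hJ.rec_succ 0)
  simp only [zero_add, Polynomial.eval_mul, Polynomial.eval_add, Polynomial.eval_X,
    Polynomial.eval_C, eval_shiftedJacobi_one hlam heps, eval_shiftedJacobi_two hlam heps, h0,
    Polynomial.eval_one] at h
  have h1 := h 1
  have h2 := h 0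
  linarith

lemma abs_sub_one_div_two_le_one {y : ℝ} (hy : |y| ≤ 1) : |(y - 1) / 2| ≤ 1 := by
  rw [abs_le] at hy ⊢
  constructor <;> linarith [hy.1, hy.2]

/-- For `z` small, `∑` and `∫` may be exchanged: the series is dominated on the support by a
convergent series of constants. -/
lemma exchange_shiftedJacobi (hlam : 1 / 2 < lam) (heps : eps = 1 ∨ eps = -1) {z : ℂ}
    (hz : lam / √(2 * lam - 1) * ‖z‖ * 20 ≤ 1) (i : ℕ) :
    ∫ x, (∑' n : ℕ, ((coeff lam n * (x ^ i * (shiftedJacobi lam eps n).eval x) : ℝ) : ℂ)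
        * z ^ n) ∂(shiftedBeta lam eps) =
      ∑' n : ℕ, ((coeff lam n * ∫ x, x ^ i * (shiftedJacobi lam eps n).eval x
        ∂(shiftedBeta lam eps) : ℝ) : ℂ) * z ^ n := by
  have hr := sqrt_pos_of_half_lt hlam
  have hl : 0 < lam := by linarith
  have hprob := isProbabilityMeasure_shiftedBeta hlam heps
  have hm := integrable_pow_shiftedBeta hlam heps
  set r := √(2 * lam - 1) with hrdef
  set M := (2 * lam + 1) / r with hM
  have hint : ∀ n, Integrable (fun x : ℝ => ((coeff lam n *
      (x ^ i * (shiftedJacobi lam eps n).eval x) : ℝ) : ℂ) * z ^ n) (shiftedBeta lam eps) := by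
    intro n
    refine Integrable.mul_const (Integrable.ofReal (Integrable.const_mul ?_ _)) _
    have h := integrable_eval hm (Polynomial.X ^ i * shiftedJacobi lam eps n)
    simpa only [Polynomial.eval_mul, Polynomial.eval_pow, Polynomial.eval_X] using h
  have hsum : Summable fun n => M ^ i * (gegenbauerComb lam 1 1 n * (lam / r * ‖z‖) ^ n) := by
    refine Summable.mul_left _ ?_
    have h := (hasSum_gegenbauerComb hl 1 1 (s := ((lam / r * ‖z‖ : ℝ) : ℂ)) (by
      rw [Complex.norm_real, Real.norm_of_nonneg (by positivity)]
      norm_num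
      linarith)).summable
    rw [← Complex.summable_ofReal]
    simpa only [Complex.ofReal_mul, Complex.ofReal_pow] using h
  have hbound : ∀ n, ∫ x, ‖((coeff lam n *
      (x ^ i * (shiftedJacobi lam eps n).eval x) : ℝ) : ℂ) * z ^ n‖ ∂(shiftedBeta lam eps) ≤
      M ^ i * (gegenbauerComb lam 1 1 n * (lam / r * ‖z‖) ^ n) := by
    intro n
    have h := norm_integral_le_of_norm_le_const (μ := shiftedBeta lam eps)
      (f := fun x : ℝ => ‖((coeff lam n *
        (x ^ i * (shiftedJacobi lam eps n).eval x) : ℝ) : ℂ) * z ^ n‖)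
      (C := M ^ i * (gegenbauerComb lam 1 1 n * (lam / r * ‖z‖) ^ n)) (by
        filter_upwards [ae_shiftedBeta (eps := eps) hlam] with x hx
        have hw := abs_sub_one_div_two_le_one hx
        have h1 := abs_gegenbauerComb_le hl (abs_eps heps).le hw n
        have h2 : |x| ^ i ≤ M ^ i :=
          pow_le_pow_left₀ (abs_nonneg _) (abs_le_of_shiftedBeta hlam heps hx) i
        rw [norm_norm, norm_mul, Complex.norm_real, Real.norm_eq_abs,
          show coeff lam n * (x ^ i * (shiftedJacobi lam eps n).eval x) =
            x ^ i * (coeff lam n * (shiftedJacobi lam eps n).eval x) by ring,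
          coeff_mul_eval_shiftedJacobi hlam heps, abs_mul, abs_mul, abs_pow, norm_pow,
          abs_of_pos (show 0 < (lam / r) ^ n by positivity), mul_pow, mul_assoc]
        refine mul_le_mul h2 ?_ (by positivity) (by positivity)
        calc (lam / r) ^ n * |gegenbauerComb lam eps ((((r * x - eps) / (2 * lam)) - 1) / 2) n|
              * ‖z‖ ^ n ≤ (lam / r) ^ n * gegenbauerComb lam 1 1 n * ‖z‖ ^ n := by gcongr
          _ = gegenbauerComb lam 1 1 n * ((lam / r) ^ n * ‖z‖ ^ n) := by ring)
    rw [probReal_univ, mul_one] at h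
    exact (le_abs_self _).trans h
  have h := (hasSum_integral_of_summable_integral_norm hint (Summable.of_nonneg_of_le
    (fun n => integral_nonneg fun x => norm_nonneg _) hbound hsum)).tsum_eq
  rw [← h]
  refine tsum_congr fun n => ?_
  rw [integral_mul_const, integral_complex_ofReal, integral_const_mul]

lemma abs_le_one_of_mem_support_shiftedBeta (hlam : 1 / 2 < lam) {x : ℝ}
    (hx : x ∈ (shiftedBeta lam eps).support) :
    |(√(2 * lam - 1) * x - eps) / (2 * lam)| ≤ 1 := by
  have hclosed : IsClosed {x : ℝ | |(√(2 * lam - 1) * x - eps) / (2 * lam)| ≤ 1} :=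
    isClosed_le (by fun_prop) continuous_const
  exact Measure.support_subset_of_isClosed hclosed (ae_shiftedBeta hlam) hx

/-- The shifted Beta distributions have a generating function of ultraspherical type. The radius of
the half disc makes `‖s‖ ≤ 1 / 20` for `s = lam z / √(2 lam - 1)`, so that the series converge for
all `|w| ≤ 1`, where `16 |w| + 4 ≤ 20`; it also makes `|z| ^ 2 < 1 / A`, so that `Im f` has the sign
opposite to `Im z`. -/
theorem hasUltrasphericalGF_shiftedJacobi (hlam : 1 / 2 < lam) (heps : eps = 1 ∨ eps = -1) :
    HasUltrasphericalGF lam (shiftedBeta lam eps) (shiftedJacobi lam eps)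
      (upperHalfDisc (√(2 * lam - 1) / (20 * lam)))
      (fun z => ((lam ^ 2 / (2 * lam - 1) : ℝ) : ℂ) * z + ((eps / √(2 * lam - 1) : ℝ) : ℂ) + z⁻¹)
      (fun z => z ^ (lam : ℂ) / (1 + lam * ((eps / √(2 * lam - 1) : ℝ) : ℂ) * z)) := by
  have hr := sqrt_pos_of_half_lt hlam
  have hr2 : √(2 * lam - 1) ^ 2 = 2 * lam - 1 := Real.sq_sqrt (by linarith)
  have hl : 0 < lam := by linarith
  set r := √(2 * lam - 1) with hrdef
  set S := upperHalfDisc (r / (20 * lam)) with hS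
  set A := lam ^ 2 / (2 * lam - 1) with hA
  set s := eps / r with hs
  have hs0 : s ≠ 0 := div_ne_zero (by rcases heps with rfl | rfl <;> norm_num) hr.ne'
  have hregion : IsCutRegion S := isCutRegion_upperHalfDisc (by positivity)
  have hne : ∀ z ∈ S, z ≠ 0 := fun z hz => hregion.ne_zero hz
  have hden : ∀ z ∈ S, (1 + lam * (s : ℂ) * z) ≠ 0 := by
    intro z hz h
    have h1 := congrArg Complex.im h
    rw [← Complex.ofReal_mul] at h1
    simp only [Complex.add_im, Complex.one_im, Complex.im_ofReal_mul, Complex.zero_im,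
      zero_add] at h1
    exact mul_ne_zero (mul_ne_zero hl.ne' hs0) hz.1.ne' h1
  have hsmall : ∀ z ∈ S, lam / r * ‖z‖ * 20 ≤ 1 := by
    intro z hz
    have h := hz.2.le
    rw [le_div_iff₀ (by positivity)] at h
    rw [div_mul_eq_mul_div, div_mul_eq_mul_div, div_le_one hr]
    linarith
  have him : ∀ z ∈ S, z.im * ((A : ℂ) * z + (s : ℂ) + z⁻¹).im < 0 := by
    intro z hz
    rw [im_mul_add_add_inv]
    have h1 : 0 < Complex.normSq z := Complex.normSq_pos.2 (hne z hz)
    have h2 : A < (Complex.normSq z)⁻¹ := by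
      rw [lt_inv_comm₀ (by rw [hA, ← hr2]; positivity) h1, Complex.normSq_eq_norm_sq, hA, ← hr2]
      have h3 := hsmall z hz
      have h4 : 0 ≤ lam / r * ‖z‖ := by positivity
      rw [← div_pow, ← one_div, lt_div_iff₀ (by positivity), ← mul_pow, mul_comm]
      nlinarith
    have := mul_pos hz.1 hz.1
    nlinarith
  refine ⟨hregion, ?_, ?_, ?_, ?_, ?_, ?_, ?_⟩
  · refine DifferentiableOn.analyticOnNhd (fun z hz => ?_) hregion.isOpen
    have h0 := hne z hz
    refine DifferentiableAt.differentiableWithinAt ?_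
    fun_prop (disch := exact h0)
  · refine DifferentiableOn.analyticOnNhd (fun z hz => ?_) hregion.isOpen
    refine DifferentiableAt.differentiableWithinAt ?_
    exact (differentiableAt_id.cpow_const (hregion.cut hz)).div (by fun_prop) (hden z hz)
  · have hc : Continuous fun z : ℂ => (A : ℂ) * z ^ 2 + s * z + 1 := by fun_prop
    have h := (hc.tendsto 0).mono_left (nhdsWithin_le_nhds (s := S))
    simp only [ne_eq, OfNat.ofNat_ne_zero, not_false_eq_true, zero_pow, mul_zero, zero_add] at h
    refine h.congr' ?_
    filter_upwards [self_mem_nhdsWithin] with z hz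
    have h0 := hne z hz
    field_simp
  · have hc : ContinuousAt (fun z : ℂ => (1 + lam * (s : ℂ) * z)⁻¹) 0 :=
      ContinuousAt.inv₀ (by fun_prop) (by simp)
    have h := hc.tendsto.mono_left (nhdsWithin_le_nhds (s := S))
    simp only [mul_zero, add_zero, inv_one] at h
    refine h.congr' ?_
    filter_upwards [self_mem_nhdsWithin] with z hz
    have hpow : z ^ (lam : ℂ) ≠ 0 := by
      rw [Ne, Complex.cpow_eq_zero_iff]
      exact fun h => hne z hz h.1
    rw [div_right_comm, div_self hpow, one_div]
  · intro z hz h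
    have h1 := him z hz
    rw [h, mul_zero] at h1
    exact h1.false
  · intro z hz x hx
    rw [one_div_mul_cpow_eq (hne z hz) (div_mul_cancel₀ _ (hden z hz)) (him z hz)]
    refine hasSum_shiftedJacobi hlam heps x (le_trans ?_ (hsmall z hz))
    have hw := abs_sub_one_div_two_le_one (abs_le_one_of_mem_support_shiftedBeta hlam hx)
    refine mul_le_mul_of_nonneg_left (by linarith) (by positivity)
  · intro z hz i _
    exact exchange_shiftedJacobi hlam heps (hsmall z hz) i

/-- The converse: both signs of `α 1` occur. -/
theorem exists_hasUltrasphericalGF (hlam : 1 / 2 < lam) (heps : eps = 1 ∨ eps = -1) :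
    ∃ (μ : Measure ℝ) (P : ℕ → ℝ[X]) (α ω : ℕ → ℝ) (S : Set ℂ) (f u : ℂ → ℂ) (a₀ a₁ a₂ : ℂ),
      IsStandard μ ∧ IsMonicOPS μ P ∧ IsJacobiSzego P α ω ∧ HasUltrasphericalGF lam μ P S f u ∧
        0 < eps * α 1 ∧
        ∀ z ∈ S, gFun lam (α 1) (ω 2) f z = (a₀ * z ^ 2 + a₁ * z + a₂) / z := by
  have hr := sqrt_pos_of_half_lt hlam
  have hl : 0 < lam := by linarith
  have hsq : eps * eps = 1 := by rcases heps with rfl | rfl <;> norm_num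
  have hG := hasUltrasphericalGF_shiftedJacobi hlam heps
  have hP := isMonicOPS_shiftedJacobi hlam heps
  obtain ⟨α, ω, hJ, -⟩ := hP.exists_isJacobiSzego (integrable_pow_shiftedBeta hlam heps)
    (momentFunctional_shiftedBeta_mul_self_pos hlam heps)
  refine ⟨_, _, α, ω, _, _, _, ((lam ^ 2 / (2 * lam - 1) : ℝ) : ℂ) - (lam + 1) * ω 2 / 2,
    ((eps / √(2 * lam - 1) : ℝ) : ℂ) - α 1 / 2, 1, isStandard_shiftedBeta hlam heps, hP, hJ, hG,
    ?_, fun z hz => ?_⟩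
  · rw [hJ.alpha_one_eq hlam heps,
      show eps * (2 * eps / ((lam + 1) * √(2 * lam - 1))) =
        2 * (eps * eps) / ((lam + 1) * √(2 * lam - 1)) by ring, hsq]
    positivity
  · have h0 := hG.region.ne_zero hz
    rw [gFun, eq_div_iff h0]
    generalize ((lam ^ 2 / (2 * lam - 1) : ℝ) : ℂ) = A
    generalize ((eps / √(2 * lam - 1) : ℝ) : ℂ) = s
    field_simp
    ring

end

end UltrasphericalType

theorem mainTheorem2 (lam : ℝ) (hlam : 1 / 2 < lam) (hlam1 : lam ≠ 1) :
    (∀ (μ : Measure ℝ) (P : ℕ → ℝ[X]) (α ω : ℕ → ℝ) (S : Set ℂ) (f u : ℂ → ℂ) (a₀ a₁ a₂ : ℂ),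
      UltrasphericalType.IsStandard μ →
      UltrasphericalType.IsMonicOPS μ P →
      UltrasphericalType.IsJacobiSzego P α ω →
      UltrasphericalType.HasUltrasphericalGF lam μ P S f u →
      α 1 ≠ 0 →
      (∀ z ∈ S, UltrasphericalType.gFun lam (α 1) (ω 2) f z = (a₀ * z ^ 2 + a₁ * z + a₂) / z) →
      ω 2 = 2 * lam ^ 3 / ((lam + 1) ^ 2 * (lam - 1 / 2)) ∧
      (α 1) ^ 2 = 2 / ((lam + 1) ^ 2 * (lam - 1 / 2)) ∧
      a₀ = (((1 - lam) * lam ^ 2 / ((lam + 1) * (2 * lam - 1)) : ℝ) : ℂ) ∧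
      a₁ = ((lam * α 1 / 2 : ℝ) : ℂ) ∧
      a₂ = 1 ∧
      (0 < α 1 →
        (∀ z ∈ S, f z = 1 / z * ((lam : ℂ) ^ 2 / (2 * (lam : ℂ) - 1) * z ^ 2
            + 1 / (√(2 * lam - 1) : ℂ) * z + 1)) ∧
        (∀ z ∈ S, u z = (√(2 * lam - 1) : ℂ) / (lam : ℂ)
            * (z ^ (lam : ℂ) / (z + (√(2 * lam - 1) : ℂ) / (lam : ℂ)))) ∧
        (∀ z ∈ S, ∀ x ∈ μ.support,
          HasSum
            (fun n : ℕ => ((UltrasphericalType.coeff lam n * (P n).eval x : ℝ) : ℂ) * z ^ n)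
            ((lam : ℂ) / (√(2 * lam - 1) : ℂ) * (z + (√(2 * lam - 1) : ℂ) / (lam : ℂ))
              * (1 - z * ((x : ℂ) - 1 / (√(2 * lam - 1) : ℂ))
                  + (lam : ℂ) ^ 2 / (2 * (lam : ℂ) - 1) * z ^ 2) ^ (-(lam : ℂ)))) ∧
        (∀ (n : ℕ) (x : ℝ), (P n).eval x = (2 * lam / √(2 * lam - 1)) ^ n
            * (UltrasphericalType.monicJacobi (lam - 1 / 2) (lam - 3 / 2) n).eval
                ((√(2 * lam - 1) * x - 1) / (2 * lam))) ∧
        (∃ c : ℝ, 0 < c ∧ μ = UltrasphericalType.betaMeasureOn c (lam - 1 / 2) (lam - 3 / 2)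
            ((1 - 2 * lam) / √(2 * lam - 1)) ((1 + 2 * lam) / √(2 * lam - 1))
            (fun x => (√(2 * lam - 1) * x - 1) / (2 * lam)))) ∧
      (α 1 < 0 →
        (∀ z ∈ S, f z = 1 / z * ((lam : ℂ) ^ 2 / (2 * (lam : ℂ) - 1) * z ^ 2
            - 1 / (√(2 * lam - 1) : ℂ) * z + 1)) ∧
        (∀ z ∈ S, u z = -((√(2 * lam - 1) : ℂ) / (lam : ℂ))
            * (z ^ (lam : ℂ) / (z - (√(2 * lam - 1) : ℂ) / (lam : ℂ)))) ∧
        (∀ z ∈ S, ∀ x ∈ μ.support,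
          HasSum
            (fun n : ℕ => ((UltrasphericalType.coeff lam n * (P n).eval x : ℝ) : ℂ) * z ^ n)
            (-((lam : ℂ) / (√(2 * lam - 1) : ℂ)) * (z - (√(2 * lam - 1) : ℂ) / (lam : ℂ))
              * (1 - z * ((x : ℂ) + 1 / (√(2 * lam - 1) : ℂ))
                  + (lam : ℂ) ^ 2 / (2 * (lam : ℂ) - 1) * z ^ 2) ^ (-(lam : ℂ)))) ∧
        (∀ (n : ℕ) (x : ℝ), (P n).eval x = (2 * lam / √(2 * lam - 1)) ^ n
            * (UltrasphericalType.monicJacobi (lam - 3 / 2) (lam - 1 / 2) n).eval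
                ((√(2 * lam - 1) * x + 1) / (2 * lam))) ∧
        (∃ c : ℝ, 0 < c ∧ μ = UltrasphericalType.betaMeasureOn c (lam - 3 / 2) (lam - 1 / 2)
            (-(1 + 2 * lam) / √(2 * lam - 1)) ((2 * lam - 1) / √(2 * lam - 1))
            (fun x => (√(2 * lam - 1) * x + 1) / (2 * lam))))) ∧
    (∀ ε : ℝ, ε = 1 ∨ ε = -1 →
      ∃ (μ : Measure ℝ) (P : ℕ → ℝ[X]) (α ω : ℕ → ℝ) (S : Set ℂ) (f u : ℂ → ℂ) (a₀ a₁ a₂ : ℂ),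
        UltrasphericalType.IsStandard μ ∧
        UltrasphericalType.IsMonicOPS μ P ∧
        UltrasphericalType.IsJacobiSzego P α ω ∧
        UltrasphericalType.HasUltrasphericalGF lam μ P S f u ∧
        0 < ε * α 1 ∧
        (∀ z ∈ S, UltrasphericalType.gFun lam (α 1) (ω 2) f z =
          (a₀ * z ^ 2 + a₁ * z + a₂) / z)) := by
  have hr := UltrasphericalType.sqrt_pos_of_half_lt hlam
  have hl : 0 < lam := by linarith
  have hrC : (√(2 * lam - 1) : ℂ) ≠ 0 := by exact_mod_cast hr.ne'
  have hlC : (lam : ℂ) ≠ 0 := by exact_mod_cast hl.ne'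
  have hA : ((lam ^ 2 / (2 * lam - 1) : ℝ) : ℂ) = (lam : ℂ) ^ 2 / (2 * (lam : ℂ) - 1) := by
    push_cast
    ring
  refine ⟨fun μ P α ω S f u a₀ a₁ a₂ hμ hP hJ hG hα hg => ?_,
    fun eps heps => UltrasphericalType.exists_hasUltrasphericalGF hlam heps⟩
  obtain ⟨h1, h2, h3, h4, h5⟩ := hG.parameters hlam hlam1 hμ hP hJ hα hg
  refine ⟨h1, h2, h3, h4, h5, fun hpos => ?_, fun hneg => ?_⟩
  · obtain ⟨hf, hu, hsum, hPn, c, hc, hμc⟩ :=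
      hG.classification hlam hlam1 hμ hP hJ (Or.inl rfl) (by linarith) hg
    have hs : ((1 / √(2 * lam - 1) : ℝ) : ℂ) = 1 / (√(2 * lam - 1) : ℂ) := by push_cast; rfl
    rw [hA, hs] at hf hsum
    rw [hs] at hu
    refine ⟨fun z hz => ?_, fun z hz => ?_, fun z hz x hx => ?_, fun n x => ?_, c, hc, ?_⟩
    · have h0 := hG.region.ne_zero hz
      rw [hf z hz]
      generalize (lam : ℂ) ^ 2 / (2 * (lam : ℂ) - 1) = A
      field_simp
    · have h0 := hG.region.ne_zero hz
      have hpow : z ^ (lam : ℂ) ≠ 0 := by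
        rw [Ne, Complex.cpow_eq_zero_iff]
        exact fun h => h0 h.1
      have hd : z + (√(2 * lam - 1) : ℂ) / (lam : ℂ) ≠ 0 := by
        intro h
        have h' := hu z hz
        rw [show 1 + (lam : ℂ) * (1 / (√(2 * lam - 1) : ℂ)) * z =
          lam / (√(2 * lam - 1) : ℂ) * (z + (√(2 * lam - 1) : ℂ) / (lam : ℂ)) by
            field_simp; ring,
          h, mul_zero, mul_zero] at h'
        exact hpow h'.symm
      rw [← hu z hz, ← mul_div_assoc, eq_div_iff hd]
      generalize u z = U
      field_simp
      ring
    · have h := hsum z hz x hx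
      rwa [show 1 + (lam : ℂ) * (1 / (√(2 * lam - 1) : ℂ)) * z =
        lam / (√(2 * lam - 1) : ℂ) * (z + (√(2 * lam - 1) : ℂ) / (lam : ℂ)) by
          field_simp; ring] at h
    · rw [hPn, UltrasphericalType.eval_shiftedJacobi, show lam - 1 + 1 / 2 = lam - 1 / 2 by ring,
        show lam - 1 - 1 / 2 = lam - 3 / 2 by ring]
    · rwa [show lam - 1 + 1 / 2 = lam - 1 / 2 by ring,
        show lam - 1 - 1 / 2 = lam - 3 / 2 by ring] at hμc
  · obtain ⟨hf, hu, hsum, hPn, c, hc, hμc⟩ :=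
      hG.classification hlam hlam1 hμ hP hJ (Or.inr rfl) (by linarith) hg
    have hs : ((-1 / √(2 * lam - 1) : ℝ) : ℂ) = -(1 / (√(2 * lam - 1) : ℂ)) := by
      push_cast
      ring
    rw [hA, hs] at hf hsum
    rw [hs] at hu
    refine ⟨fun z hz => ?_, fun z hz => ?_, fun z hz x hx => ?_, fun n x => ?_, c, hc, ?_⟩
    · have h0 := hG.region.ne_zero hz
      rw [hf z hz]
      generalize (lam : ℂ) ^ 2 / (2 * (lam : ℂ) - 1) = A
      field_simp
      ring
    · have h0 := hG.region.ne_zero hz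
      have hpow : z ^ (lam : ℂ) ≠ 0 := by
        rw [Ne, Complex.cpow_eq_zero_iff]
        exact fun h => h0 h.1
      have hd : z - (√(2 * lam - 1) : ℂ) / (lam : ℂ) ≠ 0 := by
        intro h
        have h' := hu z hz
        rw [show 1 + (lam : ℂ) * -(1 / (√(2 * lam - 1) : ℂ)) * z =
          -(lam / (√(2 * lam - 1) : ℂ)) * (z - (√(2 * lam - 1) : ℂ) / (lam : ℂ)) by
            field_simp; ring,
          h, mul_zero, mul_zero] at h'
        exact hpow h'.symm
      rw [← hu z hz, ← mul_div_assoc, eq_div_iff hd]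
      generalize u z = U
      field_simp
      ring
    · have h := hsum z hz x hx
      rwa [show 1 + (lam : ℂ) * -(1 / (√(2 * lam - 1) : ℂ)) * z =
        -(lam / (√(2 * lam - 1) : ℂ)) * (z - (√(2 * lam - 1) : ℂ) / (lam : ℂ)) by
          field_simp; ring, sub_neg_eq_add] at h
    · rw [hPn, UltrasphericalType.eval_shiftedJacobi, show lam - 1 + -1 / 2 = lam - 3 / 2 by ring,
        show lam - 1 - -1 / 2 = lam - 1 / 2 by ring, sub_neg_eq_add]
    · simp only [sub_neg_eq_add] at hμc
      rwa [show lam - 1 + -1 / 2 = lam - 3 / 2 by ring,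
        show lam - 1 - -1 / 2 = lam - 1 / 2 by ring,
        show -1 - 2 * lam = -(1 + 2 * lam) by ring,
        show -1 + 2 * lam = 2 * lam - 1 by ring] at hμc
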